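/- Let $1\le p<\infty$ and let $(X,d,\mu)$ be a complete metric space with a Borel measure $\mu$ such that $0<\mu(B)<\infty$ for all balls $B$. Assume that $\mu$ is doubling, i.e. $\mu(B(x,2r))\le C_\mu\,\mu(B(x,r))$ for all $x\in X$, $r>0$, and that $X$ supports a $p$-Poincaré inequality: there are $C>0$, $\lambda\ge1$ such that for all balls $B\subset X$, all $u\in N^{1,p}(X)$ and all upper gradients $g\in L^p(X)$ of $u$, $$\frac1{\mu(B)}\int_B|u-u_B|\,d\mu\le C\,\mathrm{diam}(B)\Bigl(\frac1{\mu(\lambda B)}\int_{\lambda B}g^p\,d\mu\Bigr)^{1/p},$$ where $u_B$ is the mean value of $u$ over $B$. **Domains.** A *domain* is a bounded nonempty connected open set $\Omega\subsetneq X$. It is a *John domain* if there are $C_\Omega\ge1$ and $x_0\in\Omega$ such that every $x\in\Omega$ can be joined to $x_0$ by a rectifiable curve $\gamma:[0,l]\to\Omega$, parameterized by arc length, with $\gamma(0)=x$, $\gamma(l)=x_0$ and $t\le C_\Omega\,\mathrm{dist}(\gamma(t),X\setminus\Omega)$ for $0\le t\le l$. It is an *almost John domain* if for each $r>0$ there is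 a closed set $F\subset\overline\Omega$ such that $\Omega\setminus F$ is a John domain and $\mathcal H^1_\infty(F)<r$, where $\mathcal H^1_\infty(F)=\inf\{\sum_j r_j:F\subset\bigcup_{j=1}^\infty B(x_j,r_j)\}$. **Ends.** A set $E\subsetneq\Omega$ is *acceptable* if it is bounded and connected and $\overline E\cap\partial\Omega\ne\emptyset$. A *chain* is a sequence $\{E_k\}_{k=1}^\infty$ of acceptable sets with $E_{k+1}\subset E_k$ and $\mathrm{dist}(\Omega\cap\partial E_{k+1},\Omega\cap\partial E_k)>0$ for all $k$, and with *impression* $\bigcap_k\overline{E_k}\subset\partial\Omega$. The chain $\{E_k\}$ *divides* $\{F_k\}$ if for each $k$ there is $l$ with $E_l\subset F_k$; chains are equivalent if they divide each other. An *end* $[E_k]$ is an equivalence class of chains; impression and division pass to ends. A *prime end* is an end which is not divisible by any other end; $\partial_P\Omega$ is the set of prime ends. **Topology.** A sequence of points $x_n\in\Omega$ converges to the end $[E_k]$ if for every $k$ we have $x_n\in E_k$ for all large $n$; a sequence of ends $[E^n_k]$ converges to $[E_k]$ if for every $k$ and all large $n$ there is $l$ with $E^n_l\subset E_k$; convergence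 of points to points of $\Omega$ is metric convergence, and no sequence of ends converges to a point of $\Omega$. A set of points and ends is closed if it contains all limits of sequences in it. The *prime end closure* $\overline\Omega^P=\Omega\cup\partial_P\Omega$ has the topology induced by this topology on the union of $\Omega$ and the set of all ends. The *Mazurkiewicz closure* $\overline\Omega^M$ is the completion of $(\Omega,d_M)$, where $d_M(x,y)=\inf\mathrm{diam}\,E$ over all connected sets $E\subset\Omega$ containing $x$ and $y$. **Modulus.** For a family $\Gamma$ of nonconstant rectifiable curves, $\mathrm{Mod}_p(\Gamma)=\inf\int_X\rho^p\,d\mu$ over all Borel $\rho:X\to[0,\infty]$ with $\int_\gamma\rho\,ds\ge1$ for all $\gamma\in\Gamma$; $\mathrm{Mod}_p(E,K,\Omega)$ is the modulus of the family of curves in $\Omega$ from $E$ to $K$. A *$\mathrm{Mod}_p$-end* is an end represented by a chain $\{E_k\}$ with $\lim_{k\to\infty}\mathrm{Mod}_p(E_k,K,\Omega)=0$ for every compact $K\subset\Omega$; it is a *$\mathrm{Mod}_p$-prime end* if the only $\mathrm{Mod}_p$-end dividing it is itself. For $x\in X$, let $Q(x)$ be the set of all $q>0$ for which there are $C_q,R_q>0$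 such that $\mu(B(x,r))/\mu(B(x,R))\le C_q(r/R)^q$ for all $0<r\le R\le R_q$. **Statement.** Let $\Omega$ be an almost John domain. Then: (a) Every end is divisible by some prime end. (b) Every prime end has a singleton impression. (c) Every $x\in\partial\Omega$ is accessible, i.e. there is a continuous $\gamma:[0,1]\to X$ with $\gamma(1)=x$ and $\gamma([0,1))\subset\Omega$; and there is at least one prime end with impression $\{x\}$. (d) There is a homeomorphism $\Phi:\overline\Omega^P\to\overline\Omega^M$ such that $\Phi|_\Omega$ is the identity map. (e) If $p\in Q(x)\ne(0,1]$ for all $x\in\partial\Omega$, then the set of $\mathrm{Mod}_p$-prime ends equals the set $\partial_P\Omega$ of prime ends. (f) The prime end closure $\overline\Omega^P$ is metrizable and compact. -/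

import Mathlib

open Set Filter Topology MeasureTheory
open scoped ENNReal NNReal

namespace PrimeEnds

/-! ### The metric measure space -/

/-- A nonconstant rectifiable curve `[0, len] → X` parameterized by arc length.
Only the restriction of `toFun` to `[0, len]` is relevant. -/
structure RectCurve (X : Type*) [PseudoEMetricSpace X] where
  len : ℝ
  len_pos : 0 < len
  toFun : ℝ → X
  unitSpeed : HasUnitSpeedOn toFun (Icc 0 len)

/-- The arc length integral of `ρ` along `γ`. -/
noncomputable def lineIntegral {X : Type*} [PseudoEMetricSpace X]
    (ρ : X → ℝ≥0∞) (γ : RectCurve X) : ℝ≥0∞ :=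
  ∫⁻ t in Icc 0 γ.len, ρ (γ.toFun t)

/-- `g` is an upper gradient of the function `u`. -/
def IsUpperGradient {X : Type*} [PseudoEMetricSpace X] [MeasurableSpace X]
    (g : X → ℝ≥0∞) (u : X → ℝ) : Prop :=
  Measurable g ∧
    ∀ γ : RectCurve X,
      ENNReal.ofReal |u (γ.toFun 0) - u (γ.toFun γ.len)| ≤ lineIntegral g γ

/-- Balls have positive and finite measure. -/
def BallsPosFinite {X : Type*} [PseudoMetricSpace X] [MeasurableSpace X]
    (μ : Measure X) : Prop :=
  ∀ (x : X) (r : ℝ), 0 < r → 0 < μ (Metric.ball x r) ∧ μ (Metric.ball x r) < ∞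

/-- The measure `μ` is doubling. -/
def IsDoubling {X : Type*} [PseudoMetricSpace X] [MeasurableSpace X]
    (μ : Measure X) : Prop :=
  ∃ C : ℝ≥0, ∀ (x : X) (r : ℝ), 0 < r →
    μ (Metric.ball x (2 * r)) ≤ C * μ (Metric.ball x r)

/-- `(X, μ)` supports a `p`-Poincaré inequality: the inequality holds on all balls, for every
measurable `u` with `∫ |u|^p < ∞` and every upper gradient `g` of `u` with `∫ g^p < ∞`
(so `u` ranges over the Newtonian space `N^{1,p}(X)`). -/
def SupportsPoincare {X : Type*} [PseudoMetricSpace X] [MeasurableSpace X]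
    (μ : Measure X) (p : ℝ) : Prop :=
  ∃ (C L : ℝ≥0), 1 ≤ L ∧
    ∀ (u : X → ℝ) (g : X → ℝ≥0∞), AEMeasurable u μ → ∫⁻ x, ‖u x‖ₑ ^ p ∂μ < ∞ →
      IsUpperGradient g u → ∫⁻ x, g x ^ p ∂μ < ∞ →
      ∀ (z : X) (r : ℝ), 0 < r →
        ⨍⁻ x in Metric.ball z r, ‖u x - ⨍ y in Metric.ball z r, u y ∂μ‖ₑ ∂μ ≤
          C * Metric.ediam (Metric.ball z r) *
            (⨍⁻ x in Metric.ball z (L * r), g x ^ p ∂μ) ^ (1 / p)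

/-- The pointwise dimension set `Q(x)`. -/
def dimSet {X : Type*} [PseudoMetricSpace X] [MeasurableSpace X]
    (μ : Measure X) (x : X) : Set ℝ :=
  {q | 0 < q ∧ ∃ C : ℝ, 0 < C ∧ ∃ R₀ : ℝ, 0 < R₀ ∧
    ∀ r R : ℝ, 0 < r → r ≤ R → R ≤ R₀ →
      μ.real (Metric.ball x r) / μ.real (Metric.ball x R) ≤ C * (r / R) ^ q}

/-- The `p`-modulus of a family of curves. -/
noncomputable def modulus {X : Type*} [PseudoEMetricSpace X] [MeasurableSpace X]
    (μ : Measure X) (p : ℝ) (Γ : Set (RectCurve X)) : ℝ≥0∞ :=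
  ⨅ (ρ : X → ℝ≥0∞) (_ : Measurable ρ) (_ : ∀ γ ∈ Γ, 1 ≤ lineIntegral ρ γ),
    ∫⁻ x, ρ x ^ p ∂μ

/-- The family `Γ(E, F, U)` of curves in `U` which start in `E` and end in `F`. -/
def curvesJoining {X : Type*} [PseudoEMetricSpace X] (E F U : Set X) : Set (RectCurve X) :=
  {γ | (∀ t ∈ Icc 0 γ.len, γ.toFun t ∈ U) ∧ γ.toFun 0 ∈ E ∧ γ.toFun γ.len ∈ F}

/-! ### Domains -/

/-- `Ω ⊊ X` is a bounded domain. -/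
def IsBoundedDomain {X : Type*} [PseudoMetricSpace X] (Ω : Set X) : Prop :=
  IsOpen Ω ∧ IsConnected Ω ∧ Bornology.IsBounded Ω ∧ Ω ≠ univ

/-- `Ω` is a John domain. The constant curve is allowed as John curve of the John center. -/
def IsJohnDomain {X : Type*} [PseudoMetricSpace X] (Ω : Set X) : Prop :=
  IsBoundedDomain Ω ∧
    ∃ C : ℝ, 1 ≤ C ∧ ∃ x₀ ∈ Ω, ∀ x ∈ Ω, ∃ (l : ℝ) (γ : ℝ → X),
      0 ≤ l ∧ HasUnitSpeedOn γ (Icc 0 l) ∧ γ 0 = x ∧ γ l = x₀ ∧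
        ∀ t ∈ Icc 0 l, γ t ∈ Ω ∧ t ≤ C * Metric.infDist (γ t) Ωᶜ

/-- The `s`-dimensional Hausdorff content. -/
noncomputable def hausdorffContent {X : Type*} [PseudoMetricSpace X] (s : ℝ) (E : Set X) :
    ℝ≥0∞ :=
  ⨅ (x : ℕ → X) (r : ℕ → ℝ) (_ : ∀ j, 0 < r j) (_ : E ⊆ ⋃ j, Metric.ball (x j) (r j)),
    ∑' j, ENNReal.ofReal (r j) ^ s

/-- `Ω` is an almost John domain. -/
def IsAlmostJohnDomain {X : Type*} [PseudoMetricSpace X] (Ω : Set X) : Prop :=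
  IsBoundedDomain Ω ∧
    ∀ r : ℝ, 0 < r → ∃ F : Set X, IsClosed F ∧ F ⊆ closure Ω ∧
      hausdorffContent 1 F < ENNReal.ofReal r ∧ IsJohnDomain (Ω \ F)

/-- `x` is an accessible boundary point of `Ω`. -/
def IsAccessible {X : Type*} [TopologicalSpace X] (Ω : Set X) (x : X) : Prop :=
  x ∈ frontier Ω ∧
    ∃ γ : ℝ → X, ContinuousOn γ (Icc 0 1) ∧ γ 1 = x ∧ ∀ t ∈ Ico (0 : ℝ) 1, γ t ∈ Ω

/-! ### Ends and prime ends -/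

/-- Acceptable sets: bounded connected `E ⊊ Ω` whose closure meets the boundary of `Ω`. -/
def IsAcceptable {X : Type*} [PseudoMetricSpace X] (Ω E : Set X) : Prop :=
  E ⊂ Ω ∧ Bornology.IsBounded E ∧ IsConnected E ∧ (closure E ∩ frontier Ω).Nonempty

/-- Chains of acceptable sets (indexed from `0`).
`Metric.AreSeparated` says that the distance of the two sets is positive. -/
structure EndChain {X : Type*} [PseudoMetricSpace X] (Ω : Set X) where
  sets : ℕ → Set X
  acceptable : ∀ k, IsAcceptable Ω (sets k)
  succ_subset : ∀ k, sets (k + 1) ⊆ sets k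
  separated : ∀ k,
    Metric.AreSeparated (Ω ∩ frontier (sets (k + 1))) (Ω ∩ frontier (sets k))
  impression_subset : ⋂ k, closure (sets k) ⊆ frontier Ω

namespace EndChain

variable {X : Type*} [PseudoMetricSpace X] {Ω : Set X}

/-- The impression of a chain. -/
def impression (E : EndChain Ω) : Set X := ⋂ k, closure (E.sets k)

/-- `E` divides `F`. -/
def Divides (E F : EndChain Ω) : Prop := ∀ k, ∃ l, E.sets l ⊆ F.sets k

theorem Divides.refl (E : EndChain Ω) : E.Divides E := fun k => ⟨k, Subset.rfl⟩

theorem Divides.trans {E F G : EndChain Ω} (h : E.Divides F) (h' : F.Divides G) :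
    E.Divides G := fun k => by
  obtain ⟨l, hl⟩ := h' k
  obtain ⟨m, hm⟩ := h l
  exact ⟨m, hm.trans hl⟩

theorem Divides.impression_subset {E F : EndChain Ω} (h : E.Divides F) :
    E.impression ⊆ F.impression := fun x hx => by
  refine mem_iInter.2 fun k => ?_
  obtain ⟨l, hl⟩ := h k
  exact closure_mono hl (mem_iInter.1 hx l)

/-- Chains are equivalent if they divide each other. -/
instance setoid (Ω : Set X) : Setoid (EndChain Ω) where
  r E F := E.Divides F ∧ F.Divides E
  iseqv :=
    { refl := fun E => ⟨Divides.refl E, Divides.refl E⟩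
      symm := fun h => ⟨h.2, h.1⟩
      trans := fun h h' => ⟨h.1.trans h'.1, h'.2.trans h.2⟩ }

/-- The sequence `E` is eventually contained in `A`. -/
def EventuallyIn (E : EndChain Ω) (A : Set X) : Prop := ∃ l, E.sets l ⊆ A

theorem EventuallyIn.of_divides {E F : EndChain Ω} {A : Set X} (h : E.Divides F)
    (hF : F.EventuallyIn A) : E.EventuallyIn A := by
  obtain ⟨k, hk⟩ := hF
  obtain ⟨l, hl⟩ := h k
  exact ⟨l, hl.trans hk⟩

/-- `E` is a `Mod_p`-chain. -/
def IsModChain [MeasurableSpace X] (μ : Measure X) (p : ℝ) (E : EndChain Ω) : Prop :=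
  ∀ K : Set X, IsCompact K → K ⊆ Ω →
    Tendsto (fun k => modulus μ p (curvesJoining (E.sets k) K Ω)) atTop (𝓝 0)

end EndChain

/-- The ends of `Ω`. -/
def DomainEnd {X : Type*} [PseudoMetricSpace X] (Ω : Set X) : Type _ :=
  Quotient (EndChain.setoid Ω)

namespace DomainEnd

variable {X : Type*} [PseudoMetricSpace X] {Ω : Set X}

/-- The end represented by a chain. -/
def mk (E : EndChain Ω) : DomainEnd Ω := Quotient.mk (EndChain.setoid Ω) E

/-- The impression of an end. -/
def impression (e : DomainEnd Ω) : Set X :=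
  Quotient.lift EndChain.impression
    (fun E F (h : E.Divides F ∧ F.Divides E) =>
      Subset.antisymm h.1.impression_subset h.2.impression_subset) e

/-- `e` divides `f`. -/
def Divides (e f : DomainEnd Ω) : Prop :=
  Quotient.lift₂ EndChain.Divides
    (fun _ _ _ _ h h' => propext
      ⟨fun H => (h.2.trans H).trans h'.1, fun H => (h.1.trans H).trans h'.2⟩) e f

/-- Some set (equivalently, all late sets) of each chain representing `e` is contained in `A`. -/
def EventuallyIn (e : DomainEnd Ω) (A : Set X) : Prop :=
  Quotient.lift (fun E : EndChain Ω => E.EventuallyIn A)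
    (fun E F (h : E.Divides F ∧ F.Divides E) => propext
      ⟨EndChain.EventuallyIn.of_divides h.2, EndChain.EventuallyIn.of_divides h.1⟩) e

/-- `e` is a prime end: no other end divides it. -/
def IsPrime (e : DomainEnd Ω) : Prop := ∀ f : DomainEnd Ω, f.Divides e → f = e

/-- `e` is a `Mod_p`-end. -/
def IsModEnd [MeasurableSpace X] (μ : Measure X) (p : ℝ) (e : DomainEnd Ω) : Prop :=
  ∃ E : EndChain Ω, E.IsModChain μ p ∧ mk E = e

/-- `e` is a `Mod_p`-prime end. -/
def IsModPrime [MeasurableSpace X] (μ : Measure X) (p : ℝ) (e : DomainEnd Ω) : Prop :=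
  e.IsModEnd μ p ∧ ∀ f : DomainEnd Ω, f.IsModEnd μ p → f.Divides e → f = e

end DomainEnd

/-! ### The topology on `Ω ∪ ∂_E Ω` -/

/-- The set `Ω ∪ ∂_E Ω`. -/
inductive EndClosure {X : Type*} [PseudoMetricSpace X] (Ω : Set X) : Type _
  | point (x : Ω) : EndClosure Ω
  | ofEnd (e : DomainEnd Ω) : EndClosure Ω

namespace EndClosure

variable {X : Type*} [PseudoMetricSpace X] {Ω : Set X}

/-- A point lies in `A`, respectively an end has a set of its chain contained in `A`. -/
def LiesIn (A : Set X) : EndClosure Ω → Prop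
  | point x => (x : X) ∈ A
  | ofEnd e => e.EventuallyIn A

/-- Convergence of sequences in `Ω ∪ ∂_E Ω`. For a sequence of points, or a sequence of ends,
tending to an end `[E_k]` this is: for each `k`, all late terms lie in `E_k`, respectively
have a set of their chain contained in `E_k`. Only points converge to points of `Ω`. -/
def ConvergesTo (y : ℕ → EndClosure Ω) : EndClosure Ω → Prop
  | point x => ∀ ε > 0, ∀ᶠ n in atTop, ∃ z : Ω, y n = point z ∧ dist z x < ε
  | ofEnd e => ∀ E : EndChain Ω, DomainEnd.mk E = e →
      ∀ k, ∀ᶠ n in atTop, (y n).LiesIn (E.sets k)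

theorem ConvergesTo.comp {y : ℕ → EndClosure Ω} {b : EndClosure Ω} (h : ConvergesTo y b)
    {φ : ℕ → ℕ} (hφ : StrictMono φ) : ConvergesTo (y ∘ φ) b := by
  cases b with
  | point x => exact fun ε hε => hφ.tendsto_atTop.eventually (h ε hε)
  | ofEnd e => exact fun E hE k => hφ.tendsto_atTop.eventually (h E hE k)

/-- `C` contains the limits of all convergent sequences in `C`. -/
def IsSeqClosedSet (C : Set (EndClosure Ω)) : Prop :=
  ∀ (y : ℕ → EndClosure Ω) (b : EndClosure Ω), (∀ n, y n ∈ C) → ConvergesTo y b → b ∈ C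

theorem IsSeqClosedSet.empty : IsSeqClosedSet (∅ : Set (EndClosure Ω)) :=
  fun _ _ h _ => (h 0).elim

theorem IsSeqClosedSet.union {C D : Set (EndClosure Ω)} (hC : IsSeqClosedSet C)
    (hD : IsSeqClosedSet D) : IsSeqClosedSet (C ∪ D) := by
  intro y b hy hb
  by_cases hf : ∃ᶠ n in atTop, y n ∈ C
  · obtain ⟨φ, hφ, hφC⟩ := extraction_of_frequently_atTop hf
    exact Or.inl (hC _ b hφC (hb.comp hφ))
  · have hf' : ∃ᶠ n in atTop, y n ∈ D := by
      rw [not_frequently] at hf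
      exact (hf.mono fun n hn => (hy n).resolve_left hn).frequently
    obtain ⟨φ, hφ, hφD⟩ := extraction_of_frequently_atTop hf'
    exact Or.inr (hD _ b hφD (hb.comp hφ))

/-- The topology whose closed sets are the sets closed under limits of sequences. -/
instance topologicalSpace : TopologicalSpace (EndClosure Ω) :=
  TopologicalSpace.ofClosed {C | IsSeqClosedSet C} IsSeqClosedSet.empty
    (fun _ hA y b hy hb => mem_sInter.2 fun C hC =>
      hA hC y b (fun n => mem_sInter.1 (hy n) C hC) hb)
    (fun _ hC _ hD => hC.union hD)

end EndClosure

/-- The prime end closure `Ω ∪ ∂_P Ω`, with the topology induced from `Ω ∪ ∂_E Ω`. -/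
abbrev PrimeEndClosure {X : Type*} [PseudoMetricSpace X] (Ω : Set X) : Type _ :=
  {y : EndClosure Ω // ∀ e : DomainEnd Ω, y = EndClosure.ofEnd e → e.IsPrime}

/-- The inclusion of `Ω` into the prime end closure. -/
def PrimeEndClosure.ofPoint {X : Type*} [PseudoMetricSpace X] {Ω : Set X} (x : Ω) :
    PrimeEndClosure Ω :=
  ⟨EndClosure.point x, fun _ h => nomatch h⟩

/-! ### The Mazurkiewicz closure -/

/-- A copy of `Ω` which is equipped with the Mazurkiewicz distance. -/
def Mazurkiewicz {X : Type*} (Ω : Set X) : Type _ := Ω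

/-- The Mazurkiewicz distance: the infimum of the diameters of the connected subsets of `Ω`
containing `x` and `y`. -/
noncomputable def mazurkiewiczDist {X : Type*} [MetricSpace X] (Ω : Set X) (x y : Ω) : ℝ≥0∞ :=
  ⨅ (E : Set X) (_ : IsConnected E ∧ E ⊆ Ω ∧ (x : X) ∈ E ∧ (y : X) ∈ E), Metric.ediam E

/-- The distance takes values in `[0, ∞]`; it is finite if `Ω` is connected and bounded. -/
noncomputable instance mazurkiewiczEMetricSpace {X : Type*} [MetricSpace X] (Ω : Set X) :
    EMetricSpace (Mazurkiewicz Ω) where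
  edist x y := mazurkiewiczDist Ω x y
  edist_self x := by
    refine le_antisymm ?_ bot_le
    refine (iInf₂_le ({(x : Ω).1} : Set X) ⟨isConnected_singleton, ?_, rfl, rfl⟩).trans ?_
    · exact Metric.ediam_singleton.le
    · exact singleton_subset_iff.2 (x : Ω).2
  edist_comm x y := by
    refine iInf_congr fun E => iInf_congr_Prop ⟨?_, ?_⟩ fun _ => rfl <;>
      exact fun h => ⟨h.1, h.2.1, h.2.2.2, h.2.2.1⟩
  edist_triangle x y z := by
    refine ENNReal.le_of_forall_pos_le_add fun ε hε hfin => ?_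
    have hε' : (ε / 2 : ℝ≥0∞) ≠ 0 := by simpa using hε.ne'
    have h1 : mazurkiewiczDist Ω x y < mazurkiewiczDist Ω x y + ε / 2 :=
      ENNReal.lt_add_right (ne_top_of_le_ne_top hfin.ne le_self_add) hε'
    have h2 : mazurkiewiczDist Ω y z < mazurkiewiczDist Ω y z + ε / 2 :=
      ENNReal.lt_add_right (ne_top_of_le_ne_top hfin.ne le_add_self) hε'
    obtain ⟨E, hE, hE'⟩ : ∃ A, ∃ _ : _, Metric.ediam A < _ := by
      simpa only [mazurkiewiczDist, iInf_lt_iff] using h1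
    obtain ⟨F, hF, hF'⟩ : ∃ A, ∃ _ : _, Metric.ediam A < _ := by
      simpa only [mazurkiewiczDist, iInf_lt_iff] using h2
    have hne : (E ∩ F).Nonempty := ⟨_, hE.2.2.2, hF.2.2.1⟩
    refine (iInf₂_le (E ∪ F) ⟨hE.1.union hne hF.1, union_subset hE.2.1 hF.2.1,
      Or.inl hE.2.2.1, Or.inr hF.2.2.2⟩).trans ?_
    refine (Metric.ediam_union_le hne).trans ((add_le_add hE'.le hF'.le).trans ?_)
    rw [add_add_add_comm, ENNReal.add_halves]
    exact le_rfl
  eq_of_edist_eq_zero {x y} h := by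
    refine Subtype.ext (edist_le_zero.1 ?_)
    rw [← h]
    exact le_iInf₂ fun E hE => Metric.edist_le_ediam_of_mem hE.2.2.1 hE.2.2.2

/-- The Mazurkiewicz closure of `Ω`: the completion of `Ω` in the Mazurkiewicz distance. -/
abbrev MazurkiewiczClosure {X : Type*} [MetricSpace X] (Ω : Set X) : Type _ :=
  UniformSpace.Completion (Mazurkiewicz Ω)

/-- The inclusion of `Ω` into the Mazurkiewicz closure. -/
noncomputable def MazurkiewiczClosure.ofPoint {X : Type*} [MetricSpace X] {Ω : Set X} (x : Ω) :
    MazurkiewiczClosure Ω :=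
  UniformSpace.Completion.coe' (show Mazurkiewicz Ω from x)

end PrimeEnds

/-! The prime ends of `Ω` are the points that the Mazurkiewicz completion adds to `Ω`. Two facts
carry this: `X` is proper and locally path connected, and `(Ω, d_M)` is totally bounded, so that its
completion `M` is compact.

Properness is a volume count from doubling. Local path connectedness follows from quasiconvexity:
the Poincaré inequality is applied to the infimal length of paths with jumps of size at most `ε`; it
yields a bound independent of `ε`, and `ε → 0` gives genuine paths (`exists_lipschitz_path`).

For total boundedness, take the closed set `F` of small content. Some small sphere around any point
of `Ω` misses `F`, so a connected set of small diameter leads from the point out of `F`. A John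
curve then leads, after a short time, to a point at distance at least `η` from the complement. Such
points form a compact subset of `Ω`, where local connectedness gives a finite cover by small
connected sets.

Let `m` be a point of `M` outside `Ω`. The components of `ball (proj m) r ∩ Ω` that contain the
points of `Ω` near `m` form a chain shrinking to `m` in `d_M` (`exists_represents`). By compactness,
every chain `F` accumulates at some `m`. The chain of `m` consists of connected sets of small
diameter which meet every `F_k`, so the positive distance between the frontiers in `F` traps its
late sets in each `F_k` (`Represents.divides`). Hence every end is divisible by an end representing
a point of `M`, and the latter ends are exactly the prime ones. The impression is `{proj m}`,
convergence to ends becomes convergence in `M`, and joining points of successive open sets of the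
chain gives accessibility.

Under the dimension hypothesis, curves from small balls around a boundary point to a fixed distance
have small modulus. Thus all prime ends are `Mod_p`-ends, and the two notions of primality agree. -/

namespace PrimeEnds

/-! ### Consequences of doubling: properness, and Lipschitz bounds from mean oscillation -/

section Doubling

variable {X : Type*} [PseudoMetricSpace X] [MeasurableSpace X] {μ : Measure X}

theorem measure_ball_two_pow_mul_le {C : ℝ≥0}
    (hC : ∀ (x : X) (r : ℝ), 0 < r → μ (Metric.ball x (2 * r)) ≤ C * μ (Metric.ball x r))
    (x : X) {r : ℝ} (hr : 0 < r) (k : ℕ) :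
    μ (Metric.ball x (2 ^ k * r)) ≤ (C : ℝ≥0∞) ^ k * μ (Metric.ball x r) := by
  induction k with
  | zero => simp
  | succ k ih =>
    rw [pow_succ', mul_assoc, pow_succ', mul_assoc]
    exact (hC x _ (by positivity)).trans (by gcongr)

/-- An infinite `ε`-separated sequence in the ball would give infinitely many disjoint balls of
radius `ε / 2`. By doubling their measures are bounded below, yet all of them lie in one ball of
finite measure. -/
theorem totallyBounded_closedBall [OpensMeasurableSpace X] (hball : BallsPosFinite μ)
    (hd : IsDoubling μ) (x : X) (R : ℝ) : TotallyBounded (Metric.closedBall x R) := by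
  obtain ⟨C, hC⟩ := hd
  rw [Metric.totallyBounded_iff]
  by_contra! h
  obtain ⟨ε, hε, h⟩ := h
  have hstep : ∀ s : Finset X, (∀ y ∈ s, y ∈ Metric.closedBall x R) →
      ∃ y, y ∈ Metric.closedBall x R ∧ ∀ z ∈ s, ε ≤ dist y z := by
    intro s _
    obtain ⟨y, hy, hy'⟩ := not_subset.1 (h s s.finite_toSet)
    refine ⟨y, hy, fun z hz => not_lt.1 fun hlt => hy' ?_⟩
    exact mem_iUnion₂.2 ⟨z, hz, hlt⟩
  obtain ⟨f, hf, hf'⟩ := exists_seq_of_forall_finset_exists _ (fun z y => ε ≤ dist y z) hstep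
  have hR : 0 ≤ R := dist_nonneg.trans (hf 0)
  obtain ⟨k, hk⟩ := pow_unbounded_of_one_lt ((2 * R + 2 * ε) / (ε / 2)) one_lt_two
  have hk' : 2 * R + 2 * ε ≤ 2 ^ k * (ε / 2) := ((div_lt_iff₀ (by positivity)).1 hk).le
  have hlow : ∀ n, μ (Metric.ball x (R + ε)) / (C : ℝ≥0∞) ^ k ≤
      μ (Metric.ball (f n) (ε / 2)) := by
    intro n
    refine ENNReal.div_le_of_le_mul ?_
    rw [mul_comm]
    refine le_trans (measure_mono ?_) (measure_ball_two_pow_mul_le hC (f n) (half_pos hε) k)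
    refine Metric.ball_subset_ball' ?_
    have := hf n
    rw [Metric.mem_closedBall, dist_comm] at this
    linarith
  have hfin := Measure.finite_const_le_meas_of_disjoint_iUnion μ
    (ε := μ (Metric.ball x (R + ε)) / (C : ℝ≥0∞) ^ k)
    (ENNReal.div_pos (hball x _ (by positivity)).1.ne' (by simp))
    (As := fun n => Metric.ball (f n) (ε / 2)) (fun n => Metric.isOpen_ball.measurableSet) ?_ ?_
  · exact infinite_univ (hfin.subset fun n _ => hlow n)
  · have key : ∀ m n, m < n →
        Disjoint (Metric.ball (f m) (ε / 2)) (Metric.ball (f n) (ε / 2)) := fun m n hmn =>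
      Metric.ball_disjoint_ball (by have := hf' m n hmn; rw [dist_comm] at this; linarith)
    intro m n hmn
    rcases lt_or_gt_of_ne hmn with h | h
    · exact key _ _ h
    · exact (key _ _ h).symm
  · refine ne_top_of_le_ne_top (hball x (R + ε) (by positivity)).2.ne
      (measure_mono (iUnion_subset fun n => Metric.ball_subset_ball' ?_))
    have := hf n
    rw [Metric.mem_closedBall] at this
    linarith

theorem properSpace_of_isDoubling [OpensMeasurableSpace X] [CompleteSpace X]
    (hball : BallsPosFinite μ) (hd : IsDoubling μ) : ProperSpace X :=
  ⟨fun x R => (totallyBounded_closedBall hball hd x R).isCompact_of_isClosed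
    Metric.isClosed_closedBall⟩

theorem enorm_setAverage_sub_le {X : Type*} [MeasurableSpace X] {μ : Measure X} {A B : Set X}
    {u : X → ℝ} {c : ℝ≥0∞} (hAB : A ⊆ B)
    (hA : μ A ≠ 0) (hB : μ B ≠ ∞) (hc : μ B ≤ c * μ A) (hu : IntegrableOn u B μ) (a : ℝ) :
    ‖(⨍ y in A, u y ∂μ) - a‖ₑ ≤ c * ⨍⁻ y in B, ‖u y - a‖ₑ ∂μ := by
  have hA' : μ A ≠ ∞ := ne_top_of_le_ne_top hB (measure_mono hAB)
  have hB' : μ B ≠ 0 := fun h => hA (measure_mono_null hAB h)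
  have : IsFiniteMeasure (μ.restrict A) := ⟨by simpa using hA'.lt_top⟩
  have h1 : (⨍ y in A, u y ∂μ) - a = ⨍ y in A, (u y - a) ∂μ := by
    have : (⨍ _y in A, a ∂μ) = a := setAverage_const hA hA' a
    conv_lhs => rw [← this]
    rw [setAverage_eq, setAverage_eq, setAverage_eq, integral_sub (hu.mono_set hAB)
      (integrable_const a), smul_sub]
  rw [h1, average]
  refine (enorm_integral_le_lintegral_enorm _).trans ?_
  rw [lintegral_smul_measure, setLAverage_eq, Measure.restrict_apply_univ, ENNReal.div_eq_inv_mul,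
    ← mul_assoc, smul_eq_mul]
  gcongr
  rw [← div_eq_mul_inv, ENNReal.le_div_iff_mul_le (by simp [hB']) (by simp [hB]), mul_comm,
    ← div_eq_mul_inv]
  exact ENNReal.div_le_of_le_mul hc

/-- A continuous function with linearly bounded mean oscillation is Lipschitz. -/
theorem dist_le_of_laverage_le [OpensMeasurableSpace X] (hball : BallsPosFinite μ) {C : ℝ≥0}
    (hC : ∀ (x : X) (r : ℝ), 0 < r → μ (Metric.ball x (2 * r)) ≤ C * μ (Metric.ball x r))
    {u : X → ℝ} (hcont : Continuous u) (hu : ∀ z r, IntegrableOn u (Metric.ball z r) μ) {K : ℝ≥0}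
    (hK : ∀ z r, 0 < r → ⨍⁻ x in Metric.ball z r, ‖u x - ⨍ y in Metric.ball z r, u y ∂μ‖ₑ ∂μ ≤
      ENNReal.ofReal (K * r)) (x y : X) :
    dist (u x) (u y) ≤ (6 * C * K + 2 * C ^ 2 * K) * dist x y := by
  have hdist : ∀ {s t b : ℝ}, 0 ≤ b → ‖s - t‖ₑ ≤ ENNReal.ofReal b → dist s t ≤ b := by
    intro s t b hb h
    rw [← edist_eq_enorm_sub, edist_dist] at h
    exact (ENNReal.ofReal_le_ofReal_iff hb).1 h
  have hcomp : ∀ {z w : X} {r s : ℝ} {c : ℝ≥0}, 0 < r → 0 < s →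
      Metric.ball w s ⊆ Metric.ball z r → μ (Metric.ball z r) ≤ c * μ (Metric.ball w s) →
      dist (⨍ y in Metric.ball w s, u y ∂μ) (⨍ y in Metric.ball z r, u y ∂μ) ≤ c * (K * r) := by
    intro z w r s c hr hs hsub hc
    refine hdist (by positivity) ((enorm_setAverage_sub_le hsub (hball w s hs).1.ne'
      (hball z r hr).2.ne hc (hu z r) _).trans ?_)
    rw [ENNReal.ofReal_mul (by positivity), ENNReal.ofReal_coe_nnreal]
    gcongr
    exact hK z r hr
  -- The averages over the balls of radius `r / 2 ^ n` tend to `u z` by continuity; telescoping,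
  -- successive differences are at most `C * K * r / 2 ^ n`.
  have hpt : ∀ (z : X) (r : ℝ), 0 < r →
      dist (⨍ y in Metric.ball z r, u y ∂μ) (u z) ≤ 2 * C * K * r := by
    intro z r hr
    have hlim : Tendsto (fun n : ℕ => ⨍ y in Metric.ball z (r / 2 ^ n), u y ∂μ) atTop
        (𝓝 (u z)) := by
      rw [Metric.tendsto_atTop']
      intro ε hε
      obtain ⟨δ, hδ, h⟩ := Metric.continuousAt_iff.1 hcont.continuousAt (ε / 2) (half_pos hε)
      obtain ⟨N, hN⟩ := pow_unbounded_of_one_lt (r / δ) one_lt_two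
      refine ⟨N, fun n hn => lt_of_le_of_lt ?_ (half_lt_self hε)⟩
      have hn' : r / 2 ^ n < δ := by
        rw [div_lt_iff₀ (by positivity), mul_comm, ← div_lt_iff₀ hδ]
        exact hN.trans_le (pow_le_pow_right₀ one_le_two hn.le)
      have hr' : 0 < r / 2 ^ n := by positivity
      refine hdist (half_pos hε).le ((enorm_setAverage_sub_le Subset.rfl (hball z _ hr').1.ne'
        (hball z _ hr').2.ne (c := 1) (by simp) (hu z _) _).trans ?_)
      rw [one_mul, setLAverage_eq]
      refine ENNReal.div_le_of_le_mul ?_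
      rw [← setLIntegral_const]
      refine setLIntegral_mono' Metric.isOpen_ball.measurableSet fun w hw => ?_
      rw [← edist_eq_enorm_sub, edist_dist]
      exact ENNReal.ofReal_le_ofReal (h (lt_trans hw hn')).le
    have := dist_le_of_le_geometric_two_of_tendsto₀ (C := 2 * C * K * r) ?_ hlim
    · simpa using this
    · intro n
      rw [dist_comm]
      have hr' : 0 < r / 2 ^ n := by positivity
      have heq : 2 * (r / 2 ^ (n + 1)) = r / 2 ^ n := by rw [pow_succ]; field_simp
      refine (hcomp (c := C) hr' (by positivity : 0 < r / 2 ^ (n + 1))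
        (Metric.ball_subset_ball ?_) ?_).trans_eq (by ring)
      · rw [← heq]; linarith [show 0 < r / 2 ^ (n + 1) by positivity]
      · rw [← heq]; exact hC z _ (by positivity)
  rcases (dist_nonneg (x := x) (y := y)).eq_or_lt with h0 | hd
  · have hins : Inseparable x y := Metric.inseparable_iff.2 h0.symm
    rw [(hins.map hcont).eq, dist_self]
    positivity
  · set d := dist x y
    -- Compare `u x`, the average over `ball x (2d)`, the average over `ball y d`, and `u y`. The
    -- errors are `4CKd`, `2C²Kd` and `2CKd`; the factor `C²` comes from `ball x (2d) ⊆ ball y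
    -- (4d)`.
    have h1 := hpt x (2 * d) (by positivity)
    have h2 := hpt y d hd
    have h3 := hcomp (c := C ^ 2) (z := x) (w := y) (r := 2 * d) (s := d) (by positivity) hd
      (Metric.ball_subset_ball' (by rw [dist_comm]; linarith)) ?_
    · have := dist_triangle4 (u x) (⨍ y in Metric.ball x (2 * d), u y ∂μ)
        (⨍ y in Metric.ball y d, u y ∂μ) (u y)
      rw [dist_comm (u x) (⨍ y in Metric.ball x (2 * d), u y ∂μ),
        dist_comm (⨍ y in Metric.ball x (2 * d), u y ∂μ)
        (⨍ y in Metric.ball y d, u y ∂μ)] at this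
      push_cast at h3
      nlinarith
    · refine le_trans (measure_mono (Metric.ball_subset_ball' (ε₂ := 2 ^ 2 * d) ?_))
        ((measure_ball_two_pow_mul_le hC y hd 2).trans_eq (by push_cast; rfl))
      linarith [show dist x y = d from rfl]

end Doubling

/-! ### Paths with jumps of size at most `ε`, and their limits -/

section ApproxPath

/-- `f` is a curve from `x` to `y`, up to jumps of size `ε`, with unit speed and length `l`. -/
structure IsApproxPath {X : Type*} [PseudoMetricSpace X] (ε : ℝ) (x y : X) (l : ℝ) (f : ℝ → X) :
    Prop where
  nonneg : 0 ≤ l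
  source : f 0 = x
  target : ∀ t, l ≤ t → f t = y
  dist_le : ∀ s t, dist (f s) (f t) ≤ |s - t| + ε

variable {X : Type*} [MetricSpace X]

theorem isApproxPath_const {ε : ℝ} (hε : 0 ≤ ε) (x : X) : IsApproxPath ε x x 0 fun _ => x :=
  ⟨le_rfl, rfl, fun _ _ => rfl, fun s t => by rw [dist_self]; positivity⟩

/-- The new path waits at `y` for the time `dist y z`, then jumps to `z`. This is why the infimal
length is 1-Lipschitz at scale `ε`, and hence continuous, with no assumption on curves in `X`. -/
theorem IsApproxPath.extend {ε l : ℝ} {x y z : X} {f : ℝ → X}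
    (h : IsApproxPath ε x y l f) (hyz : dist y z ≤ ε) :
    ∃ g, IsApproxPath ε x z (l + dist y z) g := by
  classical
  have hε : 0 ≤ ε := dist_nonneg.trans hyz
  have hl := h.nonneg
  have key : ∀ s t, s < l + dist y z → l + dist y z ≤ t → dist (f s) z ≤ |s - t| + ε := by
    intro s t hs ht
    rw [abs_sub_comm, abs_of_nonneg (by linarith)]
    rcases le_or_gt l s with hls | hls
    · rw [h.target s hls]
      linarith
    · have h1 := h.dist_le s l
      rw [h.target l le_rfl, abs_sub_comm, abs_of_pos (sub_pos.2 hls)] at h1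
      have h2 := dist_triangle (f s) y z
      linarith
  refine ⟨fun t => if t < l + dist y z then f t else z, by positivity, ?_, ?_, ?_⟩
  · split_ifs with h0
    · exact h.source
    · have h1 : dist y z = 0 := by linarith [dist_nonneg (x := y) (y := z)]
      have h2 : l = 0 := by linarith
      rw [← dist_eq_zero.1 h1, ← h.target 0 h2.le, h.source]
  · intro t ht
    rw [if_neg (not_lt.2 ht)]
  · intro s t
    split_ifs with h1 h2 h2
    · exact h.dist_le s t
    · exact key s t h1 (not_lt.1 h2)
    · rw [dist_comm, abs_sub_comm]
      exact key t s h2 (not_lt.1 h1)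
    · rw [dist_self]; positivity

/-- The infimal length of `ε`-approximate paths from `x` to `y`, truncated at `T`. -/
noncomputable def approxDist (ε T : ℝ) (x y : X) : ℝ :=
  sInf ({l | ∃ f, IsApproxPath ε x y l f} ∪ {T})

theorem bddBelow_approxDist {ε T : ℝ} (hT : 0 ≤ T) (x y : X) :
    BddBelow ({l | ∃ f, IsApproxPath ε x y l f} ∪ {T}) := by
  refine ⟨0, ?_⟩
  rintro l (⟨f, hf⟩ | rfl)
  exacts [hf.nonneg, hT]

theorem approxDist_nonneg {ε T : ℝ} (hT : 0 ≤ T) (x y : X) : 0 ≤ approxDist ε T x y := by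
  refine le_csInf ⟨T, Or.inr rfl⟩ ?_
  rintro l (⟨f, hf⟩ | rfl)
  exacts [hf.nonneg, hT]

theorem approxDist_le {ε T : ℝ} (hT : 0 ≤ T) (x y : X) : approxDist ε T x y ≤ T :=
  csInf_le (bddBelow_approxDist hT x y) (Or.inr rfl)

theorem approxDist_self {ε T : ℝ} (hε : 0 ≤ ε) (hT : 0 ≤ T) (x : X) : approxDist ε T x x = 0 :=
  le_antisymm (csInf_le (bddBelow_approxDist hT x x) (Or.inl ⟨_, isApproxPath_const hε x⟩))
    (approxDist_nonneg hT x x)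

theorem approxDist_le_add {ε T : ℝ} (hT : 0 ≤ T) (x : X) {y z : X} (h : dist y z ≤ ε) :
    approxDist ε T x z ≤ approxDist ε T x y + dist y z := by
  rw [← sub_le_iff_le_add]
  refine le_csInf ⟨T, Or.inr rfl⟩ ?_
  rintro l (⟨f, hf⟩ | rfl) <;> rw [sub_le_iff_le_add]
  · exact csInf_le (bddBelow_approxDist hT x z) (Or.inl (hf.extend h))
  · exact (approxDist_le hT x z).trans (le_add_of_nonneg_right dist_nonneg)

theorem exists_isApproxPath_of_approxDist_lt {ε T : ℝ} {x y : X}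
    (h : approxDist ε T x y < T) : ∃ f, IsApproxPath ε x y T f := by
  obtain ⟨l, hl | rfl, hlT⟩ := exists_lt_of_csInf_lt ⟨T, Or.inr rfl⟩ h
  · obtain ⟨f, hf⟩ := hl
    exact ⟨f, hf.nonneg.trans hlT.le, hf.source, fun t ht => hf.target t (hlT.le.trans ht),
      hf.dist_le⟩
  · exact absurd hlT (lt_irrefl _)

/-- In proper spaces approximate paths of bounded length have a limit. -/
theorem exists_path_of_isApproxPath [ProperSpace X] {x y : X} {T : ℝ}
    (h : ∀ ε > 0, ∃ f, IsApproxPath ε x y T f) :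
    ∃ f : ℝ → X, f 0 = x ∧ f T = y ∧ ∀ s t, dist (f s) (f t) ≤ |s - t| := by
  -- The limit is taken pointwise along an ultrafilter: all values at time `t` lie in a compact
  -- ball, and the speed bound passes to the limit as the jumps `1 / (n + 1)` vanish.
  choose f hf using fun n : ℕ => h (1 / ((n : ℝ) + 1)) Nat.one_div_pos_of_nat
  have hlim : ∀ t, ∃ z, Tendsto (fun n => f n t) (hyperfilter ℕ) (𝓝 z) := by
    intro t
    have hmem : ∀ n, f n t ∈ Metric.closedBall x (|t| + 1) := by
      intro n
      have h1 := (hf n).dist_le t 0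
      rw [(hf n).source, sub_zero] at h1
      have h2 : 1 / ((n : ℝ) + 1) ≤ 1 :=
        (div_le_one (by positivity)).2 (le_add_of_nonneg_left n.cast_nonneg)
      exact h1.trans (by linarith)
    obtain ⟨z, -, hz⟩ := (isCompact_closedBall x (|t| + 1)).ultrafilter_le_nhds
      ((hyperfilter ℕ).map fun n => f n t) (by
        rw [le_principal_iff]
        exact Ultrafilter.mem_map.2 (Eventually.of_forall hmem))
    exact ⟨z, hz⟩
  choose F hF using hlim
  have hconst : ∀ {t z}, (∀ n, f n t = z) → F t = z := fun {t z} hz =>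
    tendsto_nhds_unique (hF t) (by simpa only [hz] using tendsto_const_nhds)
  refine ⟨F, hconst fun n => (hf n).source, hconst fun n => (hf n).target T le_rfl,
    fun s t => ?_⟩
  have h0 : Tendsto (fun n : ℕ => |s - t| + 1 / ((n : ℝ) + 1)) (hyperfilter ℕ)
      (𝓝 (|s - t| + 0)) :=
    (tendsto_one_div_add_atTop_nhds_zero_nat.mono_left
      (by rw [← Nat.cofinite_eq_atTop]; exact hyperfilter_le_cofinite)).const_add _
  rw [add_zero] at h0
  exact le_of_tendsto_of_tendsto' ((hF s).dist (hF t)) h0 fun n => (hf n).dist_le s t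

end ApproxPath

/-! ### Upper gradients of functions that are 1-Lipschitz at small scales -/

section UpperGradient

theorem abs_sub_le_of_local {f : ℝ → ℝ} {ε : ℝ} (hε : 0 < ε) {a b : ℝ} (hab : a ≤ b)
    (h : ∀ s ∈ Icc a b, ∀ t ∈ Icc a b, |s - t| ≤ ε → |f s - f t| ≤ |s - t|) :
    |f a - f b| ≤ b - a := by
  have key : ∀ n : ℕ, ∀ c ∈ Icc a b, c - a ≤ n * ε → |f a - f c| ≤ c - a := by
    intro n
    induction n with
    | zero =>
      intro c hc hca
      have : c = a := le_antisymm (by simpa using hca) hc.1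
      simp [this]
    | succ n ih =>
      intro c hc hca
      push_cast at hca
      have h1 : max a (c - ε) ∈ Icc a b :=
        ⟨le_max_left _ _, max_le hab ((sub_le_self _ hε.le).trans hc.2)⟩
      have h2 : max a (c - ε) ≤ c := max_le hc.1 (sub_le_self _ hε.le)
      have h3 := ih _ h1 (by
        rcases max_cases a (c - ε) with h | h <;> rw [h.1]
        · rw [sub_self]; positivity
        · linarith)
      have h4 := h _ h1 c hc (by
        rw [abs_sub_comm, abs_of_nonneg (sub_nonneg.2 h2)]
        linarith [le_max_right a (c - ε)])
      rw [abs_sub_comm (max a (c - ε)) c, abs_of_nonneg (sub_nonneg.2 h2)] at h4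
      linarith [abs_sub_le (f a) (f (max a (c - ε))) (f c)]
  obtain ⟨n, hn⟩ := exists_nat_ge ((b - a) / ε)
  exact key n b ⟨hab, le_rfl⟩ ((div_le_iff₀ hε).1 hn)

variable {X : Type*} [PseudoMetricSpace X]

theorem dist_le_of_hasUnitSpeedOn {γ : ℝ → X} {l : ℝ} (h : HasUnitSpeedOn γ (Icc 0 l)) {s t : ℝ}
    (hs : s ∈ Icc 0 l) (ht : t ∈ Icc 0 l) : dist (γ s) (γ t) ≤ |s - t| := by
  wlog hst : s ≤ t generalizing s t
  · rw [dist_comm, abs_sub_comm]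
    exact this ht hs (le_of_not_ge hst)
  have h1 := h hs ht
  have h2 := eVariationOn.edist_le γ (s := Icc 0 l ∩ Icc s t) ⟨hs, le_rfl, hst⟩ ⟨ht, hst, le_rfl⟩
  rw [h1, edist_dist] at h2
  rw [abs_sub_comm, abs_of_nonneg (sub_nonneg.2 hst)]
  simpa using (ENNReal.ofReal_le_ofReal_iff (by simpa using hst)).1 h2

theorem continuousOn_of_hasUnitSpeedOn {γ : ℝ → X} {l : ℝ} (h : HasUnitSpeedOn γ (Icc 0 l)) :
    ContinuousOn γ (Icc 0 l) :=
  (LipschitzOnWith.of_dist_le_mul (K := 1) fun s hs t ht => by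
    rw [NNReal.coe_one, one_mul, Real.dist_eq]
    exact dist_le_of_hasUnitSpeedOn h hs ht).continuousOn

variable [MeasurableSpace X] [OpensMeasurableSpace X]

theorem isUpperGradient_indicator_ball {v : X → ℝ} {ε : ℝ} (hε : 0 < ε) (hv0 : ∀ y, 0 ≤ v y)
    {x : X} {R : ℝ} (hv : ∀ y, R ≤ dist y x → v y = 0)
    (hloc : ∀ y z, dist y z ≤ ε → |v y - v z| ≤ dist y z) :
    IsUpperGradient ((Metric.ball x R).indicator 1) v := by
  refine ⟨measurable_one.indicator Metric.isOpen_ball.measurableSet, fun γ => ?_⟩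
  have hcont := continuousOn_of_hasUnitSpeedOn γ.unitSpeed
  have key : ∀ a b, 0 ≤ a → a ≤ b → b ≤ γ.len → (∀ t ∈ Ioo a b, γ.toFun t ∈ Metric.ball x R) →
      ENNReal.ofReal |v (γ.toFun a) - v (γ.toFun b)| ≤
        lineIntegral ((Metric.ball x R).indicator 1) γ := by
    intro a b ha hab hb hin
    have h1 := abs_sub_le_of_local (f := fun t => v (γ.toFun t)) hε hab fun s hs t ht hst => by
      have := dist_le_of_hasUnitSpeedOn γ.unitSpeed (Icc_subset_Icc ha hb hs)
        (Icc_subset_Icc ha hb ht)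
      exact (hloc _ _ (this.trans hst)).trans this
    refine (ENNReal.ofReal_le_ofReal h1).trans ?_
    rw [← Real.volume_Ioo, ← setLIntegral_one]
    refine le_trans (setLIntegral_mono' measurableSet_Ioo fun t ht => ?_)
      (lintegral_mono_set (Ioo_subset_Icc_self.trans (Icc_subset_Icc ha hb)))
    rw [indicator_of_mem (hin t ht), Pi.one_apply]
  -- `S` is the set of times outside the ball. If it is nonempty, `v` vanishes at its first and last
  -- element, so the values of `v` at the two ends of the curve are each bounded by the time spent
  -- in the ball before or after.
  set S := Icc 0 γ.len ∩ {t | R ≤ dist (γ.toFun t) x} with hS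
  have hSc : IsClosed S := by
    have : ContinuousOn (fun t => dist (γ.toFun t) x) (Icc 0 γ.len) :=
      continuous_dist.comp_continuousOn (hcont.prodMk continuousOn_const)
    exact this.preimage_isClosed_of_isClosed isClosed_Icc isClosed_Ici
  have hSb : BddBelow S := ⟨0, fun t ht => ht.1.1⟩
  have hSa : BddAbove S := ⟨γ.len, fun t ht => ht.1.2⟩
  rcases S.eq_empty_or_nonempty with hempty | hne
  · refine key 0 γ.len le_rfl γ.len_pos.le le_rfl fun t ht => ?_
    by_contra hc
    rw [Metric.mem_ball, not_lt] at hc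
    exact (hempty ▸ (⟨Ioo_subset_Icc_self ht, hc⟩ : t ∈ S) : t ∈ (∅ : Set ℝ))
  · have hi := hSc.csInf_mem hne hSb
    have hs := hSc.csSup_mem hne hSa
    have k1 := key 0 (sInf S) le_rfl hi.1.1 hi.1.2 fun t ht => by
      by_contra hc
      rw [Metric.mem_ball, not_lt] at hc
      exact notMem_of_lt_csInf ht.2 hSb ⟨⟨ht.1.le, ht.2.le.trans hi.1.2⟩, hc⟩
    have k2 := key (sSup S) γ.len hs.1.1 hs.1.2 le_rfl fun t ht => by
      by_contra hc
      rw [Metric.mem_ball, not_lt] at hc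
      exact notMem_of_csSup_lt ht.1 hSa ⟨⟨hs.1.1.trans ht.1.le, ht.2.le⟩, hc⟩
    rw [hv _ hi.2, sub_zero, abs_of_nonneg (hv0 _)] at k1
    rw [hv _ hs.2, zero_sub, abs_neg, abs_of_nonneg (hv0 _)] at k2
    rcases le_total (v (γ.toFun 0)) (v (γ.toFun γ.len)) with h | h
    · refine le_trans (ENNReal.ofReal_le_ofReal ?_) k2
      rw [abs_sub_comm, abs_of_nonneg (sub_nonneg.2 h)]
      exact sub_le_self _ (hv0 _)
    · refine le_trans (ENNReal.ofReal_le_ofReal ?_) k1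
      rw [abs_of_nonneg (sub_nonneg.2 h)]
      exact sub_le_self _ (hv0 _)

end UpperGradient

/-! ### Quasiconvexity and local path connectedness from the Poincaré inequality -/

section Quasiconvex

theorem ediam_ball_le_ofReal {X : Type*} [PseudoMetricSpace X] (z : X) (r : ℝ) :
    Metric.ediam (Metric.ball z r) ≤ 2 * ENNReal.ofReal r := by
  rw [← Metric.eball_ofReal]
  exact Metric.ediam_eball_le

/-- A Poincaré inequality, applied to functions with a bounded upper gradient. -/
theorem laverage_le_of_poincare {X : Type*} [PseudoMetricSpace X] [MeasurableSpace X]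
    {μ : Measure X} {p : ℝ} (hp : 1 ≤ p) {P L : ℝ≥0} {v : X → ℝ} {g : X → ℝ≥0∞} (hg1 : ∀ x, g x ≤ 1) {z : X} {r : ℝ} (hr : 0 < r) (hL : 1 ≤ L)
    (h : ⨍⁻ x in Metric.ball z r, ‖v x - ⨍ y in Metric.ball z r, v y ∂μ‖ₑ ∂μ ≤
          P * Metric.ediam (Metric.ball z r) *
            (⨍⁻ x in Metric.ball z (L * r), g x ^ p ∂μ) ^ (1 / p)) :
    ⨍⁻ x in Metric.ball z r, ‖v x - ⨍ y in Metric.ball z r, v y ∂μ‖ₑ ∂μ ≤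
      ENNReal.ofReal ((2 * P : ℝ≥0) * r) := by
  have hp0 : 0 < p := one_pos.trans_le hp
  have hLr : 0 < (L : ℝ) * r := mul_pos (one_pos.trans_le (by exact_mod_cast hL)) hr
  have h1 : (⨍⁻ x in Metric.ball z (L * r), g x ^ p ∂μ) ^ (1 / p) ≤ 1 := by
    refine ENNReal.rpow_le_one ?_ (by positivity)
    rw [setLAverage_eq]
    refine ENNReal.div_le_of_le_mul ?_
    rw [one_mul, ← setLIntegral_one]
    exact lintegral_mono fun x => ENNReal.rpow_le_one (hg1 x) hp0.le
  refine h.trans ?_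
  calc _ ≤ P * (2 * ENNReal.ofReal r) * 1 := by gcongr; exact ediam_ball_le_ofReal z r
    _ = _ := by
      rw [mul_one, ENNReal.ofReal_mul (by positivity), ENNReal.ofReal_coe_nnreal]
      push_cast
      ring

variable {X : Type*} [MetricSpace X] [MeasurableSpace X] [BorelSpace X]
  {μ : Measure X} {p : ℝ}

/-- The truncated infimal length from `x`, cut off far away, has a bounded upper gradient, so it is
Lipschitz with a constant that does not depend on `ε`. Since it vanishes at `x`, it is below the
truncation level at `y`. -/
theorem exists_forall_isApproxPath (hp : 1 ≤ p) (hball : BallsPosFinite μ) (hd : IsDoubling μ)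
    (hpoinc : SupportsPoincare μ p) :
    ∃ K : ℝ, 1 ≤ K ∧ ∀ (x y : X), ∀ ε > 0, ∃ f, IsApproxPath ε x y (K * dist x y) f := by
  obtain ⟨C, hC⟩ := hd
  obtain ⟨P, L, hL, hP⟩ := hpoinc
  have hp0 : 0 < p := one_pos.trans_le hp
  set K₀ : ℝ≥0 := 2 * P with hK₀
  set K₁ : ℝ := 6 * C * K₀ + 2 * C ^ 2 * K₀ with hK₁
  have hK₁0 : 0 ≤ K₁ := by positivity
  refine ⟨K₁ + 1, by linarith, fun x y ε hε => ?_⟩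
  rcases (dist_nonneg (x := x) (y := y)).eq_or_lt with h0 | hdpos
  · rw [← dist_eq_zero.1 h0.symm, dist_self, mul_zero]
    exact ⟨_, isApproxPath_const hε.le x⟩
  set d := dist x y with hdd
  set T := (K₁ + 1) * d with hT
  have hT0 : 0 < T := by positivity
  -- The cutoff makes `v` vanish outside `ball x (T + d)`, as integrability requires, and equals `T`
  -- at `y`, so it does not interfere there.
  set v : X → ℝ := fun z => min (approxDist ε T x z) (max 0 (T + d - dist z x)) with hv
  have hv0 : ∀ z, 0 ≤ v z := fun z => le_min (approxDist_nonneg hT0.le x z) (le_max_left _ _)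
  have hvT : ∀ z, v z ≤ T := fun z => (min_le_left _ _).trans (approxDist_le hT0.le x z)
  have hvR : ∀ z, T + d ≤ dist z x → v z = 0 := fun z hz =>
    le_antisymm ((min_le_right _ _).trans (max_le le_rfl (by linarith))) (hv0 z)
  have hloc' : ∀ z w, dist z w ≤ ε → v z ≤ v w + dist z w := by
    intro z w hzw
    have h1 : approxDist ε T x z ≤ approxDist ε T x w + dist z w := by
      rw [dist_comm z w] at hzw ⊢
      exact approxDist_le_add hT0.le x hzw
    have h2 : T + d - dist z x ≤ T + d - dist w x + dist z w := by
      linarith [dist_triangle_left w x z]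
    have h3 : max 0 (T + d - dist z x) ≤ max 0 (T + d - dist w x) + dist z w :=
      max_le (add_nonneg (le_max_left _ _) dist_nonneg)
        (h2.trans (by gcongr; exact le_max_right _ _))
    rw [hv]
    dsimp only
    rw [← min_add_add_right]
    exact min_le_min h1 h3
  have hloc : ∀ z w, dist z w ≤ ε → |v z - v w| ≤ dist z w := by
    intro z w hzw
    refine abs_sub_le_iff.2 ⟨?_, ?_⟩
    · linarith [hloc' z w hzw]
    · rw [dist_comm] at hzw ⊢
      linarith [hloc' w z hzw]
  have hcont : Continuous v := by
    refine Metric.continuous_iff.2 fun z δ hδ => ⟨min ε δ, lt_min hε hδ, fun w hw => ?_⟩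
    exact (hloc w z (hw.le.trans (min_le_left _ _))).trans_lt (hw.trans_le (min_le_right _ _))
  have hgrad := isUpperGradient_indicator_ball hε hv0 hvR hloc
  have hind : ∀ z, (Metric.ball x (T + d)).indicator (1 : X → ℝ≥0∞) z ^ p =
      (Metric.ball x (T + d)).indicator 1 z := by
    intro z
    by_cases hz : z ∈ Metric.ball x (T + d)
    · simp [indicator_of_mem hz]
    · simp [indicator_of_notMem hz, hp0]
  have hTd : 0 < T + d := by positivity
  have hvp : ∫⁻ z, ‖v z‖ₑ ^ p ∂μ < ∞ := by
    refine lt_of_le_of_lt (lintegral_mono (g := (Metric.ball x (T + d)).indicator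
      fun _ => ENNReal.ofReal T ^ p) fun z => ?_) ?_
    · by_cases hz : z ∈ Metric.ball x (T + d)
      · rw [indicator_of_mem hz, Real.enorm_of_nonneg (hv0 z)]
        exact ENNReal.rpow_le_rpow (ENNReal.ofReal_le_ofReal (hvT z)) hp0.le
      · rw [hvR z (not_lt.1 hz)]
        simp [hp0]
    · rw [lintegral_indicator_const Metric.isOpen_ball.measurableSet]
      exact ENNReal.mul_lt_top (ENNReal.rpow_lt_top_of_nonneg hp0.le ENNReal.ofReal_ne_top)
        (hball x _ hTd).2
  have hgp : ∫⁻ z, (Metric.ball x (T + d)).indicator (1 : X → ℝ≥0∞) z ^ p ∂μ < ∞ := by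
    simp_rw [hind]
    rw [lintegral_indicator_one Metric.isOpen_ball.measurableSet]
    exact (hball x _ hTd).2
  have hint : ∀ z r, IntegrableOn v (Metric.ball z r) μ := by
    intro z r
    rcases le_or_gt r 0 with hr | hr
    · rw [Metric.ball_eq_empty.2 hr]
      exact integrableOn_empty
    · refine Measure.integrableOn_of_bounded (M := T) (hball z r hr).2.ne
        hcont.aestronglyMeasurable (Eventually.of_forall fun w => ?_)
      rw [Real.norm_of_nonneg (hv0 w)]
      exact hvT w
  have hlip := dist_le_of_laverage_le hball hC hcont hint (K := K₀) (fun z r hr =>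
    laverage_le_of_poincare hp (fun w => indicator_le_self' (fun _ _ => bot_le) w) hr hL
      (hP v _ hcont.measurable.aemeasurable hvp hgrad hgp z r hr)) x y
  have hvx : v x = 0 := by
    rw [hv]
    dsimp only
    rw [approxDist_self hε.le hT0.le]
    exact min_eq_left (le_max_left _ _)
  rw [hvx, Real.dist_eq, zero_sub, abs_neg, abs_of_nonneg (hv0 y)] at hlip
  refine exists_isApproxPath_of_approxDist_lt (not_le.1 fun hle => ?_)
  -- If no approximate path of length below `T` existed, then `v y ≥ T = (K₁ + 1) * d`, against the
  -- Lipschitz bound `v y ≤ K₁ * d`.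
  have h1 : T ≤ v y := le_min hle (le_max_of_le_right (by rw [dist_comm y x]; linarith))
  have h2 : T = K₁ * d + d := by rw [hT]; ring
  have h3 : v y ≤ K₁ * d := hlip
  linarith

variable [CompleteSpace X]

/-- Quasiconvexity of spaces which support a Poincaré inequality. -/
theorem exists_lipschitz_path (hp : 1 ≤ p) (hball : BallsPosFinite μ) (hd : IsDoubling μ)
    (hpoinc : SupportsPoincare μ p) :
    ∃ K : ℝ, 1 ≤ K ∧ ∀ x y : X, ∃ f : ℝ → X, f 0 = x ∧ f (K * dist x y) = y ∧
      ∀ s t, dist (f s) (f t) ≤ |s - t| := by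
  have := properSpace_of_isDoubling hball hd
  obtain ⟨K, hK1, hK⟩ := exists_forall_isApproxPath hp hball hd hpoinc
  exact ⟨K, hK1, fun x y => exists_path_of_isApproxPath fun ε hε => hK x y ε hε⟩

theorem exists_joinedIn_ball (hp : 1 ≤ p) (hball : BallsPosFinite μ) (hd : IsDoubling μ)
    (hpoinc : SupportsPoincare μ p) :
    ∃ K : ℝ, 1 ≤ K ∧ ∀ (x y : X) (r : ℝ), K * dist x y < r →
      JoinedIn (Metric.ball x r) x y := by
  obtain ⟨K, hK1, hK⟩ := exists_lipschitz_path hp hball hd hpoinc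
  refine ⟨K, hK1, fun x y r hr => ?_⟩
  obtain ⟨f, hf0, hf1, hf⟩ := hK x y
  have hc : Continuous f := (LipschitzWith.of_dist_le_mul (K := 1) fun s t => by
    rw [NNReal.coe_one, one_mul]; exact hf s t).continuous
  refine JoinedIn.ofLine (f := fun t => f (t * (K * dist x y))) ?_ ?_ ?_ ?_
  · exact (hc.comp (continuous_id.mul continuous_const)).continuousOn
  · simpa using hf0
  · simpa using hf1
  · rintro _ ⟨t, ht, rfl⟩
    have h0 : 0 ≤ K * dist x y := mul_nonneg (zero_le_one.trans hK1) dist_nonneg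
    have h1 := hf (t * (K * dist x y)) 0
    rw [hf0, sub_zero, abs_of_nonneg (mul_nonneg ht.1 h0)] at h1
    exact (h1.trans (mul_le_of_le_one_left h0 ht.2)).trans_lt hr

theorem locallyPathConnectedSpace_of_poincare (hp : 1 ≤ p) (hball : BallsPosFinite μ)
    (hd : IsDoubling μ) (hpoinc : SupportsPoincare μ p) : LocallyPathConnectedSpace X := by
  obtain ⟨K, hK1, hK⟩ := exists_joinedIn_ball hp hball hd hpoinc
  have hK0 : 0 < K := one_pos.trans_le hK1
  rw [locallyPathConnectedSpace_iff_pathComponentIn_mem_nhds]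
  intro x u hu hxu
  obtain ⟨r, hr, hru⟩ := Metric.isOpen_iff.1 hu x hxu
  refine mem_of_superset (Metric.ball_mem_nhds x (div_pos hr hK0)) fun y hy => ?_
  refine (hK x y r ?_).mono hru
  rw [Metric.mem_ball', lt_div_iff₀ hK0, mul_comm] at hy
  exact hy

end Quasiconvex

/-! ### Almost John domains are totally bounded in the Mazurkiewicz distance -/

section TotallyBounded

/-- The distance to `x` is 1-Lipschitz, so it maps the covering balls into intervals of total length
below `2r`, which cannot cover `(0, 2r)`. -/
theorem exists_sphere_disjoint {X : Type*} [PseudoMetricSpace X] {F : Set X} {r : ℝ}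
    (hF : hausdorffContent 1 F < ENNReal.ofReal r) (x : X) :
    ∃ s ∈ Ioo 0 (2 * r), ∀ y ∈ F, dist y x ≠ s := by
  simp only [hausdorffContent, iInf_lt_iff] at hF
  obtain ⟨c, ρ, hρ, hcov, hsum⟩ := hF
  simp only [ENNReal.rpow_one] at hsum
  by_contra! h
  have hsub : Ioo 0 (2 * r) ⊆ ⋃ j, Ioo (dist (c j) x - ρ j) (dist (c j) x + ρ j) := by
    intro s hs
    obtain ⟨y, hy, rfl⟩ := h s hs
    obtain ⟨j, hj⟩ := mem_iUnion.1 (hcov hy)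
    rw [Metric.mem_ball] at hj
    refine mem_iUnion.2 ⟨j, ?_, ?_⟩
    · linarith [dist_triangle_left (c j) x y]
    · linarith [dist_triangle y (c j) x]
  have h1 := (measure_mono hsub).trans (measure_iUnion_le (μ := volume) _)
  simp only [Real.volume_Ioo, sub_zero] at h1
  have h2 : ∀ j, ENNReal.ofReal (dist (c j) x + ρ j - (dist (c j) x - ρ j)) =
      2 * ENNReal.ofReal (ρ j) := by
    intro j
    rw [show dist (c j) x + ρ j - (dist (c j) x - ρ j) = 2 * ρ j by ring,
      ENNReal.ofReal_mul zero_le_two, ENNReal.ofReal_ofNat]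
  simp only [h2, ENNReal.tsum_mul_left, ENNReal.ofReal_mul zero_le_two, ENNReal.ofReal_ofNat] at h1
  exact absurd (lt_of_le_of_lt ((ENNReal.mul_le_mul_iff_right (by simp) (by simp)).1 h1) hsum)
    (lt_irrefl _)

variable {X : Type*} [MetricSpace X] {Ω : Set X}

theorem mazurkiewiczDist_le_ediam {A : Set X} (hA : IsConnected A) (hAΩ : A ⊆ Ω) {x y : Ω}
    (hx : (x : X) ∈ A) (hy : (y : X) ∈ A) : mazurkiewiczDist Ω x y ≤ Metric.ediam A :=
  iInf₂_le A ⟨hA, hAΩ, hx, hy⟩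

theorem mazurkiewiczDist_le_of_subset_closedBall {A : Set X} (hA : IsConnected A) (hAΩ : A ⊆ Ω)
    {x y : Ω} (hx : (x : X) ∈ A) (hy : (y : X) ∈ A) {z : X} {r : ℝ}
    (hr : A ⊆ Metric.closedBall z r) : mazurkiewiczDist Ω x y ≤ ENNReal.ofReal (2 * r) := by
  refine (mazurkiewiczDist_le_ediam hA hAΩ hx hy).trans (Metric.ediam_le fun a ha b hb => ?_)
  rw [edist_dist]
  refine ENNReal.ofReal_le_ofReal ?_
  linarith [dist_triangle_right a b z, Metric.mem_closedBall.1 (hr ha),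
    Metric.mem_closedBall.1 (hr hb)]

/-- In a path connected set, a small set in the sense of content can be avoided by a small
connected set. -/
theorem exists_notMem_mazurkiewiczDist_le (hΩ : IsPathConnected Ω) {F : Set X} {r : ℝ}
    (hF : hausdorffContent 1 F < ENNReal.ofReal r) (hne : (Ω \ F).Nonempty) (x : Ω) :
    ∃ y : Ω, (y : X) ∉ F ∧ mazurkiewiczDist Ω x y ≤ ENNReal.ofReal (4 * r) := by
  obtain ⟨s, hs, hsF⟩ := exists_sphere_disjoint hF (x : X)
  have hle : ENNReal.ofReal (2 * s) ≤ ENNReal.ofReal (4 * r) :=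
    ENNReal.ofReal_le_ofReal (by linarith [hs.2])
  by_cases hball : Ω ⊆ Metric.closedBall x s
  · obtain ⟨w, hw, hwF⟩ := hne
    exact ⟨⟨w, hw⟩, hwF, (mazurkiewiczDist_le_of_subset_closedBall hΩ.isConnected Subset.rfl x.2
      hw hball).trans hle⟩
  · obtain ⟨w, hw, hws⟩ := not_subset.1 hball
    rw [Metric.mem_closedBall, not_le] at hws
    obtain ⟨p, hp⟩ := hΩ.joinedIn x x.2 w hw
    have hc : Continuous fun t => dist (p t) (x : X) := p.continuous.dist continuous_const
    -- The path is stopped when it first reaches the sphere of radius `s`, which misses `F`; up to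
    -- then it stays in the closed ball.
    set S := {t : unitInterval | s ≤ dist (p t) (x : X)} with hS
    have hSc : IsCompact S := (isClosed_le continuous_const hc).isCompact
    have hSne : S.Nonempty := ⟨1, by simpa [hS] using hws.le⟩
    obtain ⟨t₁, ht₁, hmin⟩ := hSc.exists_isLeast hSne
    have hA : IsConnected (p '' Icc 0 t₁) :=
      (isConnected_Icc bot_le).image _ p.continuous.continuousOn
    obtain ⟨t, ht, hts⟩ := intermediate_value_Icc (a := 0) (b := t₁) bot_le hc.continuousOn
      (show s ∈ Icc _ _ from ⟨by simpa using hs.1.le, ht₁⟩)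
    have htt : t = t₁ := le_antisymm ht.2 (hmin hts.ge)
    subst htt
    refine ⟨⟨p t, hp t⟩, fun h => hsF _ h hts, le_trans ?_ hle⟩
    refine mazurkiewiczDist_le_of_subset_closedBall (z := x) hA ?_ ⟨0, ⟨le_rfl, bot_le⟩, by simp⟩
      ⟨t, ⟨bot_le, le_rfl⟩, rfl⟩ ?_
    · rintro _ ⟨u, -, rfl⟩
      exact hp u
    · rintro _ ⟨u, hu, rfl⟩
      rw [Metric.mem_closedBall]
      rcases hu.2.eq_or_lt with rfl | hlt
      · exact hts.le
      · exact (not_le.1 fun h => hlt.not_ge (hmin h)).le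

/-- Follow the John curve for time `δ`: the point reached is at distance at least `δ / C` from the
complement, unless the curve has already ended at the center. Hence the two terms in the minimum. -/
theorem IsJohnDomain.exists_mazurkiewiczDist_le {F : Set X} (hΩ : IsOpen Ω)
    (huniv : Ω ≠ univ) (hJ : IsJohnDomain (Ω \ F)) {δ : ℝ} (hδ : 0 < δ) :
    ∃ η > 0, ∀ y : Ω, (y : X) ∉ F →
      ∃ z : Ω, η ≤ Metric.infDist (z : X) Ωᶜ ∧ mazurkiewiczDist Ω y z ≤ ENNReal.ofReal (2 * δ) := by
  obtain ⟨-, C, hC, x₀, hx₀, hJ⟩ := hJ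
  have hne : (Ωᶜ).Nonempty := nonempty_compl.2 huniv
  have hC0 : 0 < C := one_pos.trans_le hC
  refine ⟨min (δ / C) (Metric.infDist x₀ Ωᶜ), lt_min (by positivity)
    ((hΩ.isClosed_compl.notMem_iff_infDist_pos hne).1 fun h => h hx₀.1), fun y hy => ?_⟩
  obtain ⟨l, γ, hl, hγ, h0, h1, hγC⟩ := hJ y ⟨y.2, hy⟩
  have hcont := continuousOn_of_hasUnitSpeedOn hγ
  have key : ∀ b ∈ Icc 0 l, b ≤ δ → ∀ hb : γ b ∈ Ω,
      mazurkiewiczDist Ω y ⟨γ b, hb⟩ ≤ ENNReal.ofReal (2 * δ) := by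
    intro b hb hbδ hbΩ
    have hsub : Icc 0 b ⊆ Icc 0 l := Icc_subset_Icc le_rfl hb.2
    refine mazurkiewiczDist_le_of_subset_closedBall (z := y) (A := γ '' Icc 0 b)
      ((isConnected_Icc hb.1).image _ (hcont.mono hsub)) ?_ ⟨0, ⟨le_rfl, hb.1⟩, h0⟩
      ⟨b, ⟨hb.1, le_rfl⟩, rfl⟩ ?_
    · rintro _ ⟨t, ht, rfl⟩
      exact (hγC t (hsub ht)).1.1
    · rintro _ ⟨t, ht, rfl⟩
      have := dist_le_of_hasUnitSpeedOn hγ (hsub ht) (s := t) (t := 0) ⟨le_rfl, hl⟩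
      rw [h0, sub_zero, abs_of_nonneg ht.1] at this
      exact this.trans (ht.2.trans hbδ)
  rcases le_or_gt l δ with hlδ | hlδ
  · exact ⟨⟨γ l, h1 ▸ hx₀.1⟩, by simp [h1], key l ⟨hl, le_rfl⟩ hlδ _⟩
  · have hmem : δ ∈ Icc 0 l := ⟨hδ.le, hlδ.le⟩
    refine ⟨⟨γ δ, (hγC δ hmem).1.1⟩, (min_le_left _ _).trans ?_, key δ hmem le_rfl _⟩
    rw [div_le_iff₀ hC0, mul_comm]
    refine (hγC δ hmem).2.trans ?_
    exact mul_le_mul_of_nonneg_left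
      (Metric.infDist_le_infDist_of_subset (compl_subset_compl.2 sdiff_subset) hne) hC0.le

theorem connectedComponentIn_ball_mem_nhds [LocallyConnectedSpace X] (hΩ : IsOpen Ω) {x : X}
    (hx : x ∈ Ω) {δ : ℝ} (hδ : 0 < δ) :
    connectedComponentIn (Metric.ball x δ ∩ Ω) x ∈ 𝓝 x :=
  (Metric.isOpen_ball.inter hΩ).connectedComponentIn.mem_nhds
    (mem_connectedComponentIn ⟨Metric.mem_ball_self hδ, hx⟩)

theorem mazurkiewiczDist_le_of_mem_connectedComponentIn {y z : Ω} {x w : X} {δ : ℝ}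
    (hy : (y : X) ∈ connectedComponentIn (Metric.ball w δ ∩ Ω) x)
    (hz : (z : X) ∈ connectedComponentIn (Metric.ball w δ ∩ Ω) x) :
    mazurkiewiczDist Ω y z ≤ ENNReal.ofReal (2 * δ) :=
  mazurkiewiczDist_le_of_subset_closedBall
    ⟨⟨_, hy⟩, isPreconnected_connectedComponentIn⟩
    ((connectedComponentIn_subset _ _).trans inter_subset_right) hy hz
    ((connectedComponentIn_subset _ _).trans (inter_subset_left.trans
      Metric.ball_subset_closedBall))

theorem totallyBounded_mazurkiewicz [ProperSpace X] [LocallyPathConnectedSpace X]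
    (hΩ : IsAlmostJohnDomain Ω) : TotallyBounded (univ : Set (Mazurkiewicz Ω)) := by
  obtain ⟨⟨hopen, hconn, hbdd, huniv⟩, hJ⟩ := hΩ
  have hpath : IsPathConnected Ω := hopen.isConnected_iff_isPathConnected.1 hconn
  rw [EMetric.totallyBounded_iff]
  intro ε hε
  obtain ⟨a, ha0, ha⟩ := ENNReal.lt_iff_exists_nnreal_btwn.1 hε
  -- The three moves (out of `F`, along the John curve, to the center of a covering component) cost
  -- `4δ`, `2δ` and `2δ`.
  set δ : ℝ := a / 8 with hδdef
  have hδ : 0 < δ := by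
    have : (0 : ℝ) < a := by exact_mod_cast ha0
    positivity
  obtain ⟨F, -, -, hF, hJF⟩ := hJ δ hδ
  have hne : (Ω \ F).Nonempty := hJF.1.2.1.nonempty
  obtain ⟨η, hη, hηF⟩ := hJF.exists_mazurkiewiczDist_le hopen huniv hδ
  set K := closure Ω ∩ {z | η ≤ Metric.infDist z Ωᶜ} with hK
  have hKc : IsCompact K := hbdd.isCompact_closure.inter_right
    (isClosed_le continuous_const (Metric.continuous_infDist_pt _))
  have hKΩ : ∀ z ∈ K, z ∈ Ω := by
    intro z hz
    by_contra h
    have := hz.2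
    rw [mem_ofPred_eq, Metric.infDist_zero_of_mem (s := Ωᶜ) h] at this
    linarith
  obtain ⟨t, ht⟩ := hKc.elim_nhds_subcover'
    (fun z _ => connectedComponentIn (Metric.ball z δ ∩ Ω) z)
    (fun z hz => connectedComponentIn_ball_mem_nhds hopen (hKΩ z hz) hδ)
  refine ⟨(fun z : K => (⟨z, hKΩ z z.2⟩ : Ω)) '' t, t.finite_toSet.image _, fun x _ => ?_⟩
  obtain ⟨y, hyF, hy⟩ := exists_notMem_mazurkiewiczDist_le hpath hF hne x
  obtain ⟨z, hzη, hz⟩ := hηF y hyF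
  obtain ⟨w, hwt, hw⟩ := mem_iUnion₂.1 (ht ⟨subset_closure z.2, hzη⟩)
  refine mem_iUnion₂.2 ⟨(⟨w, hKΩ w w.2⟩ : Ω), ⟨w, hwt, rfl⟩, ?_⟩
  have hw' : mazurkiewiczDist Ω z ⟨w, hKΩ w w.2⟩ ≤ ENNReal.ofReal (2 * δ) :=
    mazurkiewiczDist_le_of_mem_connectedComponentIn (x := (w : X)) (w := (w : X)) hw
      (mem_connectedComponentIn ⟨Metric.mem_ball_self hδ, hKΩ w w.2⟩)
  have htri : mazurkiewiczDist Ω x ⟨w, hKΩ w w.2⟩ ≤ mazurkiewiczDist Ω x y +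
      mazurkiewiczDist Ω y z + mazurkiewiczDist Ω z ⟨w, hKΩ w w.2⟩ :=
    edist_triangle4 (α := Mazurkiewicz Ω) x y z _
  refine lt_of_le_of_lt (htri.trans (add_le_add (add_le_add hy hz) hw')) (lt_of_le_of_lt ?_ ha)
  rw [← ENNReal.ofReal_add (by positivity) (by positivity),
    ← ENNReal.ofReal_add (by positivity) (by positivity), ← ENNReal.ofReal_coe_nnreal]
  refine ENNReal.ofReal_le_ofReal (le_of_eq ?_)
  rw [hδdef]
  ring

end TotallyBounded

/-! ### Separation of the frontiers in a chain -/

section Chains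

variable {X : Type*} [MetricSpace X] {Ω : Set X}

theorem EndChain.nonempty (E : EndChain Ω) (k : ℕ) : (E.sets k).Nonempty :=
  (E.acceptable k).2.2.1.nonempty

theorem EndChain.subset (E : EndChain Ω) (k : ℕ) : E.sets k ⊆ Ω := (E.acceptable k).1.subset

theorem EndChain.antitone (E : EndChain Ω) : Antitone E.sets :=
  antitone_nat_of_succ_le E.succ_subset

/-- A connected set which meets both a set and its complement meets its frontier. -/
theorem _root_.IsPreconnected.inter_frontier_nonempty {Y : Type*} [TopologicalSpace Y]
    {A U : Set Y} (hA : IsPreconnected A) (h : (A ∩ U).Nonempty) (h' : ¬ A ⊆ U) :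
    (A ∩ frontier U).Nonempty := by
  by_contra hemp
  obtain ⟨a, haA, haU⟩ := h
  obtain ⟨b, hbA, hbU⟩ := not_subset.1 h'
  have hnot : ∀ c ∈ A, c ∉ frontier U := fun c hc hcU => hemp ⟨c, hc, hcU⟩
  obtain ⟨c, hcA, hc1, hc2⟩ := hA (interior U) (closure U)ᶜ isOpen_interior
    isClosed_closure.isOpen_compl
    (fun c hc => by
      by_cases hcU : c ∈ closure U
      · left
        by_contra hci
        exact hnot c hc ⟨hcU, hci⟩
      · exact Or.inr hcU)
    ⟨a, haA, by_contra fun hai => hnot a haA ⟨subset_closure haU, hai⟩⟩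
    ⟨b, hbA, fun hbc => hnot b hbA ⟨hbc, fun hbi => hbU (interior_subset hbi)⟩⟩
  exact hc2 (subset_closure (interior_subset hc1))

/-- Small connected sets which meet a set of a chain are contained in the preceding set. -/
theorem EndChain.exists_subset_of_connected (F : EndChain Ω) (k : ℕ) :
    ∃ ε > 0, ∀ A : Set X, IsPreconnected A → A ⊆ Ω → (∀ a ∈ A, ∀ b ∈ A, dist a b < ε) →
      (A ∩ F.sets (k + 1)).Nonempty → A ⊆ F.sets k := by
  obtain ⟨r, hr0, hr⟩ := F.separated k
  obtain ⟨ε, hε0, hε⟩ := ENNReal.lt_iff_exists_nnreal_btwn.1 (pos_iff_ne_zero.2 hr0)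
  refine ⟨ε, by exact_mod_cast hε0, fun A hA hAΩ hdiam hne => by_contra fun hnot => ?_⟩
  obtain ⟨a, haA, ha⟩ := hA.inter_frontier_nonempty hne
    (fun h => hnot (h.trans (F.succ_subset k)))
  obtain ⟨b, hbA, hb⟩ := hA.inter_frontier_nonempty
    (hne.mono (inter_subset_inter_right A (F.succ_subset k))) hnot
  have h1 := hr a ⟨hAΩ haA, ha⟩ b ⟨hAΩ hbA, hb⟩
  have h2 : edist a b < ε := by
    rw [edist_dist, ← ENNReal.ofReal_coe_nnreal]
    exact (ENNReal.ofReal_lt_ofReal_iff (by exact_mod_cast hε0)).2 (hdiam a haA b hbA)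
  exact absurd (h1.trans_lt (h2.trans hε)) (lt_irrefl _)

end Chains

/-! ### The Mazurkiewicz completion and its projection to the closure of the domain -/

section Completion

variable {X : Type*} [MetricSpace X] {Ω : Set X} {M : Type*} [MetricSpace M]

/-- `M` contains the domain with its Mazurkiewicz distance as a dense subspace. -/
structure IsMazurkiewiczEmbedding (ι : Ω → M) : Prop where
  edist_eq : ∀ x y, edist (ι x) (ι y) = mazurkiewiczDist Ω x y
  dense : DenseRange ι

namespace IsMazurkiewiczEmbedding

variable {ι : Ω → M} (hι : IsMazurkiewiczEmbedding ι)
include hι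

theorem dist_le (x y : Ω) : dist (x : X) y ≤ dist (ι x) (ι y) := by
  have : edist (x : X) y ≤ edist (ι x) (ι y) := by
    rw [hι.edist_eq]
    exact le_iInf₂ fun A hA => Metric.edist_le_ediam_of_mem hA.2.2.1 hA.2.2.2
  rw [edist_dist, edist_dist] at this
  exact (ENNReal.ofReal_le_ofReal_iff dist_nonneg).1 this

theorem injective : Function.Injective ι := fun x y h => by
  have := hι.dist_le x y
  rw [h, dist_self] at this
  exact Subtype.ext (dist_le_zero.1 this)

theorem dist_le_of_mazurkiewiczDist_le {x y : Ω} {r : ℝ} (hr : 0 ≤ r)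
    (h : mazurkiewiczDist Ω x y ≤ ENNReal.ofReal r) : dist (ι x) (ι y) ≤ r := by
  rw [← hι.edist_eq, edist_dist] at h
  exact (ENNReal.ofReal_le_ofReal_iff hr).1 h

theorem exists_dist_lt (m : M) {ε : ℝ} (hε : 0 < ε) : ∃ z : Ω, dist (ι z) m < ε := by
  obtain ⟨z, hz⟩ := hι.dense.exists_dist_lt m hε
  exact ⟨z, by rwa [dist_comm]⟩

theorem exists_proj [CompleteSpace X] (m : M) : ∃ x : X, ∀ z : Ω, dist (z : X) x ≤ dist (ι z) m := by
  choose z hz using fun n : ℕ => hι.exists_dist_lt m (ε := 1 / ((n : ℝ) + 1))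
    Nat.one_div_pos_of_nat
  have hlim : Tendsto (fun n => ι (z n)) atTop (𝓝 m) :=
    tendsto_iff_dist_tendsto_zero.2 (squeeze_zero (fun _ => dist_nonneg) (fun n => (hz n).le)
      tendsto_one_div_add_atTop_nhds_zero_nat)
  have hc : CauchySeq fun n => (z n : X) := by
    refine Metric.cauchySeq_iff.2 fun ε hε => ?_
    obtain ⟨N, hN⟩ := Metric.cauchySeq_iff.1 hlim.cauchySeq ε hε
    exact ⟨N, fun a ha b hb => (hι.dist_le _ _).trans_lt (hN a ha b hb)⟩
  obtain ⟨x, hx⟩ := cauchySeq_tendsto_of_complete hc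
  exact ⟨x, fun w => le_of_tendsto_of_tendsto' (tendsto_const_nhds.dist hx)
    (tendsto_const_nhds.dist hlim) fun n => hι.dist_le w (z n)⟩

theorem exists_dist_lt_of_dist_lt [LocallyConnectedSpace X] (hΩ : IsOpen Ω) (x : Ω) {ε : ℝ} (hε : 0 < ε) :
    ∃ δ > 0, ∀ z : Ω, dist (z : X) x < δ → dist (ι z) (ι x) < ε := by
  have h3 : 0 < ε / 3 := by positivity
  obtain ⟨δ, hδ, h⟩ := Metric.mem_nhds_iff.1 (connectedComponentIn_ball_mem_nhds hΩ x.2 h3)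
  refine ⟨δ, hδ, fun z hz => lt_of_le_of_lt (hι.dist_le_of_mazurkiewiczDist_le (by positivity)
    (mazurkiewiczDist_le_of_mem_connectedComponentIn (h hz) (h (Metric.mem_ball_self hδ)))) ?_⟩
  linarith

variable [CompleteSpace X]

/-- The extension of the inclusion of the domain. -/
noncomputable def proj (m : M) : X := (hι.exists_proj m).choose

theorem dist_proj_le (z : Ω) (m : M) : dist (z : X) (hι.proj m) ≤ dist (ι z) m :=
  (hι.exists_proj m).choose_spec z

theorem proj_apply (z : Ω) : hι.proj (ι z) = z := by
  have := hι.dist_proj_le z (ι z)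
  rw [dist_self] at this
  exact (dist_le_zero.1 this).symm

theorem proj_mem_closure (m : M) : hι.proj m ∈ closure Ω :=
  Metric.mem_closure_iff.2 fun ε hε => by
    obtain ⟨z, hz⟩ := hι.exists_dist_lt m hε
    exact ⟨z, z.2, by rw [dist_comm]; exact (hι.dist_proj_le z m).trans_lt hz⟩

theorem dist_proj_proj_le (m m' : M) : dist (hι.proj m) (hι.proj m') ≤ dist m m' := by
  refine le_of_forall_pos_le_add fun ε hε => ?_
  obtain ⟨z, hz⟩ := hι.exists_dist_lt m (half_pos hε)
  have h1 := hι.dist_proj_le z m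
  have h2 := hι.dist_proj_le z m'
  have h3 := dist_triangle_left (hι.proj m) (hι.proj m') (z : X)
  have h4 := dist_triangle (ι z) m m'
  linarith

theorem continuous_proj : Continuous hι.proj :=
  (LipschitzWith.of_dist_le_mul (K := 1) fun m m' => by
    rw [NNReal.coe_one, one_mul]
    exact hι.dist_proj_proj_le m m').continuous

variable [LocallyPathConnectedSpace X] (hΩ : IsOpen Ω)
include hΩ

/-- By local connectedness `d_M` and `d` induce the same topology on `Ω`. Points of `Ω` tending to
`m` tend to `proj m` in `d`, hence in `d_M`, so nothing new lies above `Ω`. -/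
theorem apply_proj {m : M} (hm : hι.proj m ∈ Ω) : ι ⟨hι.proj m, hm⟩ = m := by
  refine eq_of_forall_dist_le fun ε hε => ?_
  obtain ⟨δ, hδ, h⟩ := hι.exists_dist_lt_of_dist_lt hΩ ⟨hι.proj m, hm⟩ (half_pos hε)
  obtain ⟨z, hz⟩ := hι.exists_dist_lt m (lt_min (half_pos hε) hδ)
  have h1 := h z ((hι.dist_proj_le z m).trans_lt (hz.trans_le (min_le_right _ _)))
  have h2 := hz.trans_le (min_le_left _ _)
  have h3 := dist_triangle_left (ι ⟨hι.proj m, hm⟩) m (ι z)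
  linarith

theorem proj_mem_iff {m : M} : hι.proj m ∈ Ω ↔ m ∈ range ι :=
  ⟨fun h => ⟨_, hι.apply_proj hΩ h⟩, by rintro ⟨z, rfl⟩; rw [hι.proj_apply]; exact z.2⟩

theorem proj_mem_frontier {m : M} (hm : m ∉ range ι) : hι.proj m ∈ frontier Ω := by
  rw [hΩ.frontier_eq]
  exact ⟨hι.proj_mem_closure m, fun h => hm ((hι.proj_mem_iff hΩ).1 h)⟩

/-- The connected component of `ball (proj m) r ∩ Ω` which contains the points near `m`. -/
theorem exists_component (m : M) {r : ℝ} (hr : 0 < r) :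
    ∃ U : Set X, IsOpen U ∧ IsConnected U ∧ U ⊆ Metric.ball (hι.proj m) r ∩ Ω ∧
      (∀ z : Ω, dist (ι z) m < r / 4 → (z : X) ∈ U) ∧
      Ω ∩ frontier U ⊆ Metric.sphere (hι.proj m) r := by
  set x := hι.proj m with hx
  have h4 : 0 < r / 4 := by positivity
  have hopen : IsOpen (Metric.ball x r ∩ Ω) := Metric.isOpen_ball.inter hΩ
  obtain ⟨z₀, hz₀⟩ := hι.exists_dist_lt m h4
  have hz₀x : dist (z₀ : X) x < r / 4 := (hι.dist_proj_le z₀ m).trans_lt hz₀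
  have hz₀m : (z₀ : X) ∈ Metric.ball x r ∩ Ω := ⟨by rw [Metric.mem_ball]; linarith, z₀.2⟩
  refine ⟨connectedComponentIn (Metric.ball x r ∩ Ω) z₀, hopen.connectedComponentIn,
    isConnected_connectedComponentIn_iff.2 hz₀m, connectedComponentIn_subset _ _, ?_, ?_⟩
  · intro z hz
    -- Some connected set joins `z` to `z₀` with diameter below `r / 2`; as `z₀` is within `r / 4`
    -- of `x`, that set stays in the ball and so in one component.
    have hd : edist (ι z) (ι z₀) < ENNReal.ofReal (r / 2) := by
      rw [edist_dist, ENNReal.ofReal_lt_ofReal_iff (by positivity)]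
      linarith [dist_triangle_right (ι z) (ι z₀) m]
    rw [hι.edist_eq] at hd
    simp only [mazurkiewiczDist, iInf_lt_iff] at hd
    obtain ⟨A, ⟨hA, hAΩ, hzA, hz₀A⟩, hAd⟩ := hd
    have hsub : A ⊆ Metric.ball x r ∩ Ω := fun a ha => ⟨?_, hAΩ ha⟩
    · exact hA.2.subset_connectedComponentIn hz₀A hsub hzA
    have h1 : edist a z₀ < ENNReal.ofReal (r / 2) :=
      (Metric.edist_le_ediam_of_mem ha hz₀A).trans_lt hAd
    rw [edist_dist, ENNReal.ofReal_lt_ofReal_iff (by positivity)] at h1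
    rw [Metric.mem_ball]
    linarith [dist_triangle a z₀ x]
  · rintro y ⟨hyΩ, hy⟩
    have hyc : y ∈ Metric.closedBall x r := Metric.closure_ball_subset_closedBall
      (closure_mono ((connectedComponentIn_subset _ _).trans inter_subset_left)
        (frontier_subset_closure hy))
    rcases (Metric.mem_closedBall.1 hyc).lt_or_eq with hlt | heq
    · exfalso
      have hyb : y ∈ Metric.ball x r ∩ Ω := ⟨hlt, hyΩ⟩
      have hyopen : IsOpen (connectedComponentIn (Metric.ball x r ∩ Ω) y) :=
        hopen.connectedComponentIn
      obtain ⟨w, hwy, hwz⟩ := mem_closure_iff.1 (frontier_subset_closure hy) _ hyopen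
        (mem_connectedComponentIn hyb)
      rw [connectedComponentIn_eq hwz, ← connectedComponentIn_eq hwy] at hy
      rw [hyopen.frontier_eq] at hy
      exact hy.2 (mem_connectedComponentIn hyb)
    · exact heq

end IsMazurkiewiczEmbedding

end Completion

/-! ### Chains that represent points of the completion -/

section Represents

variable {X : Type*} [MetricSpace X] {Ω : Set X} {M : Type*} [MetricSpace M]

/-- The sets of the chain `E` form a basis of the trace on `Ω` of the neighborhoods of `m`. -/
structure EndChain.Represents (ι : Ω → M) (E : EndChain Ω) (m : M) : Prop where
  exists_mem : ∀ k, ∃ δ > 0, ∀ z : Ω, dist (ι z) m < δ → (z : X) ∈ E.sets k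
  exists_dist_lt : ∀ ε > 0, ∃ k, ∀ z : Ω, (z : X) ∈ E.sets k → dist (ι z) m < ε

/-- `m` is an accumulation point of all sets of the chain `F`. -/
def EndChain.AccumulatesAt (ι : Ω → M) (F : EndChain Ω) (m : M) : Prop :=
  ∀ k, ∀ δ > 0, ∃ z : Ω, (z : X) ∈ F.sets k ∧ dist (ι z) m < δ

namespace EndChain

variable {ι : Ω → M} {E F : EndChain Ω} {m m' : M}

theorem Represents.of_equiv (h : E.Represents ι m) (hEF : E.Divides F) (hFE : F.Divides E) :
    F.Represents ι m := by
  refine ⟨fun k => ?_, fun ε hε => ?_⟩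
  · obtain ⟨l, hl⟩ := hEF k
    obtain ⟨δ, hδ, h'⟩ := h.exists_mem l
    exact ⟨δ, hδ, fun z hz => hl (h' z hz)⟩
  · obtain ⟨l, hl⟩ := h.exists_dist_lt ε hε
    obtain ⟨k, hk⟩ := hFE l
    exact ⟨k, fun z hz => hl z (hk hz)⟩

theorem Represents.eq_of_divides (h : E.Represents ι m) (h' : F.Represents ι m')
    (hEF : E.Divides F) : m = m' := by
  refine eq_of_forall_dist_le fun ε hε => ?_
  obtain ⟨k, hk⟩ := h.exists_dist_lt (ε / 2) (half_pos hε)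
  obtain ⟨k', hk'⟩ := h'.exists_dist_lt (ε / 2) (half_pos hε)
  obtain ⟨l, hl⟩ := hEF k'
  obtain ⟨z, hz⟩ := E.nonempty (max k l)
  have h1 := hk ⟨z, E.subset _ hz⟩ (E.antitone (le_max_left _ _) hz)
  have h2 := hk' ⟨z, E.subset _ hz⟩ (hl (E.antitone (le_max_right _ _) hz))
  linarith [dist_triangle_left m m' (ι ⟨z, E.subset _ hz⟩)]

variable (hι : IsMazurkiewiczEmbedding ι)
include hι

theorem Represents.exists_dist_lt_of_mem (h : E.Represents ι m) {ε : ℝ} (hε : 0 < ε) :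
    ∃ k, ∀ a ∈ E.sets k, ∀ b ∈ E.sets k, dist a b < ε := by
  obtain ⟨k, hk⟩ := h.exists_dist_lt (ε / 2) (half_pos hε)
  refine ⟨k, fun a ha b hb => ?_⟩
  have h1 := hk ⟨a, E.subset _ ha⟩ ha
  have h2 := hk ⟨b, E.subset _ hb⟩ hb
  have h3 := hι.dist_le ⟨a, E.subset _ ha⟩ ⟨b, E.subset _ hb⟩
  have h4 := dist_triangle_right (ι ⟨a, E.subset _ ha⟩) (ι ⟨b, E.subset _ hb⟩) m
  dsimp only at h3
  linarith

theorem Represents.divides (h : E.Represents ι m) (hF : F.AccumulatesAt ι m) : E.Divides F := by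
  intro k
  obtain ⟨ε, hε, hk⟩ := F.exists_subset_of_connected k
  obtain ⟨l, hl⟩ := h.exists_dist_lt_of_mem hι hε
  obtain ⟨δ, hδ, hδl⟩ := h.exists_mem l
  obtain ⟨z, hzF, hz⟩ := hF (k + 1) δ hδ
  exact ⟨l, hk _ (E.acceptable l).2.2.1.isPreconnected (E.subset l) hl ⟨z, hδl z hz, hzF⟩⟩

omit hι in
theorem Represents.accumulatesAt (hι : DenseRange ι) (h : E.Represents ι m) :
    E.AccumulatesAt ι m := by
  intro k δ hδ
  obtain ⟨δ', hδ', h'⟩ := h.exists_mem k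
  obtain ⟨z, hz⟩ := hι.exists_dist_lt m (lt_min hδ hδ')
  rw [dist_comm] at hz
  exact ⟨z, h' z (hz.trans_le (min_le_right _ _)), hz.trans_le (min_le_left _ _)⟩

variable [CompleteSpace X]

theorem Represents.exists_dist_proj_lt (h : E.Represents ι m) {ε : ℝ} (hε : 0 < ε) :
    ∃ k, ∀ y ∈ E.sets k, dist y (hι.proj m) < ε := by
  obtain ⟨k, hk⟩ := h.exists_dist_lt ε hε
  exact ⟨k, fun y hy => (hι.dist_proj_le ⟨y, E.subset k hy⟩ m).trans_lt (hk _ hy)⟩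

theorem Represents.impression_eq (h : E.Represents ι m) : E.impression = {hι.proj m} := by
  refine Subset.antisymm (fun x hx => ?_) (singleton_subset_iff.2 (mem_iInter.2 fun k => ?_))
  · refine eq_of_forall_dist_le fun ε hε => ?_
    obtain ⟨k, hk⟩ := h.exists_dist_lt (ε / 2) (half_pos hε)
    obtain ⟨z, hz, hxz⟩ := Metric.mem_closure_iff.1 (mem_iInter.1 hx k) (ε / 2) (half_pos hε)
    have h1 := hk ⟨z, E.subset _ hz⟩ hz
    have h2 := hι.dist_proj_le ⟨z, E.subset _ hz⟩ m
    have h3 := dist_triangle x z (hι.proj m)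
    dsimp only at h2
    linarith
  · refine Metric.mem_closure_iff.2 fun ε hε => ?_
    obtain ⟨z, hz, hzm⟩ := h.accumulatesAt hι.dense k ε hε
    exact ⟨z, hz, by rw [dist_comm]; exact (hι.dist_proj_le z m).trans_lt hzm⟩

/-- The sets are the components at radii decreasing to zero. Their frontiers in `Ω` lie on
concentric spheres, which gives nesting and separation. Openness is recorded for accessibility. -/
theorem exists_represents [LocallyPathConnectedSpace X] (hΩ : IsOpen Ω)
    (hm : m ∉ range ι) :
    ∃ E : EndChain Ω, E.Represents ι m ∧ ∀ k, IsOpen (E.sets k) := by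
  choose! U hUo hUc hUb hUm hUf using fun r (hr : (0 : ℝ) < r) => hι.exists_component hΩ m hr
  set x := hι.proj m with hx
  have hxf : x ∈ frontier Ω := hι.proj_mem_frontier hΩ hm
  have hxΩ : x ∉ Ω := fun h => hm ((hι.proj_mem_iff hΩ).1 h)
  obtain ⟨w, hw⟩ : Ω.Nonempty := closure_nonempty_iff.1 ⟨x, frontier_subset_closure hxf⟩
  have hR : 0 < dist w x := dist_pos.2 fun h => hxΩ (h ▸ hw)
  -- Radii at most `dist w x` keep `w` out of every set, so that each is a proper subset of `Ω`.
  set R : ℕ → ℝ := fun k => dist w x / (k + 1) with hRdef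
  have hRpos : ∀ k, 0 < R k := fun k => by positivity
  have hRle : ∀ k, R k ≤ dist w x := fun k =>
    div_le_self hR.le (le_add_of_nonneg_left k.cast_nonneg)
  have hRlt : ∀ k, R (k + 1) < R k := fun k => by
    refine div_lt_div_of_pos_left hR (by positivity) ?_
    push_cast
    linarith
  have hRlim : Tendsto R atTop (𝓝 0) := by
    simpa [hRdef, div_eq_mul_inv] using
      (tendsto_one_div_add_atTop_nhds_zero_nat (𝕜 := ℝ)).const_mul (dist w x)
  have hnear : ∀ r, 0 < r → ∃ z : Ω, dist (ι z) m < r / 4 ∧ (z : X) ∈ U r := fun r hr => by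
    obtain ⟨z, hz⟩ := hι.exists_dist_lt m (ε := r / 4) (by positivity)
    exact ⟨z, hz, hUm r hr z hz⟩
  have hmono : ∀ r s, 0 < r → r < s → U r ⊆ U s := by
    intro r s hr hrs
    by_contra hnot
    obtain ⟨z, hz, hzU⟩ := hnear r hr
    obtain ⟨y, hyr, hys⟩ := (hUc r hr).isPreconnected.inter_frontier_nonempty
      ⟨z, hzU, hUm s (hr.trans hrs) z (by linarith)⟩ hnot
    have h1 := (hUb r hr hyr).1
    have h2 := hUf s (hr.trans hrs) ⟨(hUb r hr hyr).2, hys⟩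
    rw [Metric.mem_ball] at h1
    rw [Metric.mem_sphere] at h2
    linarith
  have hxU : ∀ r, 0 < r → x ∈ closure (U r) := by
    intro r hr
    refine Metric.mem_closure_iff.2 fun ε hε => ?_
    obtain ⟨z, hz⟩ := hι.exists_dist_lt m (lt_min hε (by positivity : 0 < r / 4))
    refine ⟨z, hUm r hr z (hz.trans_le (min_le_right _ _)), ?_⟩
    rw [dist_comm]
    exact (hι.dist_proj_le z m).trans_lt (hz.trans_le (min_le_left _ _))
  refine ⟨⟨fun k => U (R k), fun k => ⟨?_, ?_, hUc _ (hRpos k), x, hxU _ (hRpos k), hxf⟩,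
    fun k => hmono _ _ (hRpos _) (hRlt k), fun k => ?_, fun y hy => ?_⟩, ⟨fun k => ?_, ?_⟩,
    fun k => hUo _ (hRpos k)⟩
  · refine ⟨fun y hy => (hUb _ (hRpos k) hy).2, fun h => ?_⟩
    exact (hRle k).not_gt (hUb _ (hRpos k) (h hw)).1
  · exact Metric.isBounded_ball.subset fun y hy => (hUb _ (hRpos k) hy).1
  · refine ⟨ENNReal.ofReal (R k - R (k + 1)), ?_, fun a ha b hb => ?_⟩
    · simpa using hRlt k
    · rw [edist_dist]
      have h1 := Metric.mem_sphere.1 (hUf _ (hRpos (k + 1)) ha)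
      have h2 := Metric.mem_sphere.1 (hUf _ (hRpos k) hb)
      refine ENNReal.ofReal_le_ofReal ?_
      linarith [dist_triangle_left b x a]
  · have hyx : y = x := by
      refine eq_of_forall_dist_le fun ε hε => ?_
      obtain ⟨k, hk⟩ := (hRlim.eventually_lt_const hε).exists
      have h1 := closure_mono ((hUb _ (hRpos k)).trans inter_subset_left) (mem_iInter.1 hy k)
      exact (Metric.closure_ball_subset_closedBall h1).trans hk.le
    exact hyx ▸ hxf
  · exact ⟨R k / 4, by have := hRpos k; positivity, fun z hz => hUm _ (hRpos k) z hz⟩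
  · intro ε hε
    obtain ⟨k, hk⟩ := (hRlim.eventually_lt_const (by positivity : 0 < ε / 4)).exists
    refine ⟨k, fun z hz => ?_⟩
    obtain ⟨w', hw', hw'U⟩ := hnear _ (hRpos k)
    have h1 := hι.dist_le_of_mazurkiewiczDist_le (x := z) (y := w') (r := 2 * R k)
      (by have := hRpos k; positivity)
      (mazurkiewiczDist_le_of_subset_closedBall (hUc _ (hRpos k))
        (fun y hy => (hUb _ (hRpos k) hy).2) hz hw'U
        (fun y hy => Metric.ball_subset_closedBall (hUb _ (hRpos k) hy).1))
    linarith [dist_triangle (ι z) (ι w') m]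

end EndChain

end Represents

/-! ### Prime ends correspond to the added points of the completion -/

section Ends

variable {X : Type*} [MetricSpace X] {Ω : Set X} {M : Type*} [MetricSpace M] {ι : Ω → M}

theorem EndChain.AccumulatesAt.notMem_range [CompleteSpace X] [LocallyPathConnectedSpace X]
    (hι : IsMazurkiewiczEmbedding ι) (hΩ : IsOpen Ω) {F : EndChain Ω} {m : M}
    (h : F.AccumulatesAt ι m) : m ∉ range ι := by
  intro hmr
  have h1 : hι.proj m ∈ F.impression := by
    refine mem_iInter.2 fun k => Metric.mem_closure_iff.2 fun ε hε => ?_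
    obtain ⟨z, hz, hzm⟩ := h k ε hε
    exact ⟨z, hz, by rw [dist_comm]; exact (hι.dist_proj_le z m).trans_lt hzm⟩
  have h2 := F.impression_subset h1
  rw [hΩ.frontier_eq] at h2
  exact h2.2 ((hι.proj_mem_iff hΩ).2 hmr)

theorem EndChain.exists_accumulatesAt [CompactSpace M] (ι : Ω → M) (F : EndChain Ω) :
    ∃ m, F.AccumulatesAt ι m := by
  have hne : (⋂ k, closure (ι '' {z | (z : X) ∈ F.sets k})).Nonempty := by
    refine IsCompact.nonempty_iInter_of_sequence_nonempty_isCompact_isClosed _ (fun k => ?_)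
      (fun k => ?_) isClosed_closure.isCompact fun k => isClosed_closure
    · exact closure_mono (image_mono fun z hz => F.succ_subset k hz)
    · obtain ⟨z, hz⟩ := F.nonempty k
      exact ⟨_, subset_closure ⟨⟨z, F.subset k hz⟩, hz, rfl⟩⟩
  obtain ⟨m, hm⟩ := hne
  refine ⟨m, fun k δ hδ => ?_⟩
  obtain ⟨_, ⟨z, hz, rfl⟩, hzm⟩ := Metric.mem_closure_iff.1 (mem_iInter.1 hm k) δ hδ
  exact ⟨z, hz, by rwa [dist_comm]⟩

theorem DomainEnd.mk_eq_mk {E F : EndChain Ω} :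
    DomainEnd.mk E = DomainEnd.mk F ↔ E.Divides F ∧ F.Divides E := Quotient.eq

theorem DomainEnd.exists_mk (e : DomainEnd Ω) : ∃ E, DomainEnd.mk E = e := Quotient.exists_rep e

variable (hι : IsMazurkiewiczEmbedding ι) [CompleteSpace X] [LocallyPathConnectedSpace X]
  (hΩ : IsOpen Ω)
include hι hΩ

theorem EndChain.AccumulatesAt.represents {F : EndChain Ω} {m : M} (h : F.AccumulatesAt ι m)
    (hF : (DomainEnd.mk F).IsPrime) : F.Represents ι m := by
  obtain ⟨E, hE, -⟩ := EndChain.exists_represents hι hΩ (h.notMem_range hι hΩ)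
  obtain ⟨h1, h2⟩ := DomainEnd.mk_eq_mk.1 (hF (DomainEnd.mk E) (hE.divides hι h))
  exact hE.of_equiv h1 h2

variable [CompactSpace M]

/-- A chain `G` dividing `E` accumulates at some `m'`, whose chain `E'` divides `G` and hence `E`.
This forces `m' = m`, so `E` divides `E'` and therefore `G`. -/
theorem EndChain.Represents.isPrime {E : EndChain Ω} {m : M} (h : E.Represents ι m) :
    (DomainEnd.mk E).IsPrime := by
  intro f hf
  obtain ⟨G, rfl⟩ := f.exists_mk
  obtain ⟨m', hm'⟩ := G.exists_accumulatesAt ι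
  obtain ⟨E', hE', -⟩ := EndChain.exists_represents hι hΩ (hm'.notMem_range hι hΩ)
  have h1 : E'.Divides G := hE'.divides hι hm'
  have hGE : G.Divides E := hf
  obtain rfl := hE'.eq_of_divides h (h1.trans hGE)
  exact DomainEnd.mk_eq_mk.2 ⟨hGE, (h.divides hι (hE'.accumulatesAt hι.dense)).trans h1⟩

theorem DomainEnd.exists_isPrime_divides (e : DomainEnd Ω) :
    ∃ f : DomainEnd Ω, f.IsPrime ∧ f.Divides e := by
  obtain ⟨F, rfl⟩ := e.exists_mk
  obtain ⟨m, hm⟩ := F.exists_accumulatesAt ι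
  obtain ⟨E, hE, -⟩ := EndChain.exists_represents hι hΩ (hm.notMem_range hι hΩ)
  exact ⟨DomainEnd.mk E, hE.isPrime hι hΩ, hE.divides hι hm⟩

theorem DomainEnd.IsPrime.exists_represents {e : DomainEnd Ω} (he : e.IsPrime) :
    ∃ E m, DomainEnd.mk E = e ∧ E.Represents ι m := by
  obtain ⟨E, rfl⟩ := e.exists_mk
  obtain ⟨m, hm⟩ := E.exists_accumulatesAt ι
  exact ⟨E, m, rfl, hm.represents hι hΩ he⟩

theorem DomainEnd.IsPrime.exists_impression_eq {e : DomainEnd Ω} (he : e.IsPrime) :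
    ∃ x : X, e.impression = {x} := by
  obtain ⟨E, m, rfl, hE⟩ := he.exists_represents hι hΩ
  exact ⟨_, hE.impression_eq hι⟩

theorem exists_represents_of_mem_frontier {x : X} (hx : x ∈ frontier Ω) :
    ∃ (E : EndChain Ω) (m : M), E.Represents ι m ∧ (∀ k, IsOpen (E.sets k)) ∧
      E.impression = {x} := by
  -- The image of the compact space `M` is closed and contains `Ω`, so every boundary point is a
  -- projection.
  have hsub : closure Ω ⊆ range hι.proj :=
    closure_minimal (fun z hz => ⟨ι ⟨z, hz⟩, hι.proj_apply ⟨z, hz⟩⟩)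
      (isCompact_range hι.continuous_proj).isClosed
  obtain ⟨m, rfl⟩ := hsub (frontier_subset_closure hx)
  rw [hΩ.frontier_eq] at hx
  obtain ⟨E, hE, hEo⟩ := EndChain.exists_represents hι hΩ (m := m)
    fun h => hx.2 ((hι.proj_mem_iff hΩ).2 h)
  exact ⟨E, m, hE, hEo, hE.impression_eq hι⟩

end Ends

/-! ### Accessibility of boundary points -/

section Accessible

theorem exists_concatenation {Y : Type*} [TopologicalSpace Y] {w : ℕ → Y} {S : ℕ → Set Y}
    (h : ∀ k, JoinedIn (S k) (w k) (w (k + 1))) :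
    ∃ g : ℝ → Y, ContinuousOn g (Ici 0) ∧ ∀ t, g t ∈ S ⌊t⌋₊ := by
  set p : ∀ k, Path (w k) (w (k + 1)) := fun k => (h k).somePath
  have hpS : ∀ k t, (p k).extend t ∈ S k := fun k t => by
    have : (p k).extend t ∈ range (p k).extend := mem_range_self t
    rw [Path.extend_range] at this
    obtain ⟨s, hs⟩ := this
    exact hs ▸ (h k).somePath_mem s
  refine ⟨fun t => (p ⌊t⌋₊).extend (t - ⌊t⌋₊), ?_, fun t => hpS _ _⟩
  have hpiece : ∀ k : ℕ, ∀ t ∈ Icc (k : ℝ) (k + 1),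
      (p ⌊t⌋₊).extend (t - ⌊t⌋₊) = (p k).extend (t - k) := by
    intro k t ht
    rcases ht.2.lt_or_eq with hlt | rfl
    · rw [(Nat.floor_eq_iff (k.cast_nonneg.trans ht.1)).2 ⟨ht.1, hlt⟩]
    · have : ⌊(k : ℝ) + 1⌋₊ = k + 1 := by exact_mod_cast Nat.floor_natCast (R := ℝ) (k + 1)
      rw [this]
      push_cast
      simp
  have hfin : ∀ n : ℕ, ContinuousOn (fun t : ℝ => (p ⌊t⌋₊).extend (t - ⌊t⌋₊)) (Icc 0 n) := by
    intro n
    induction n with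
    | zero => simp
    | succ n ih =>
      push_cast
      rw [← Icc_union_Icc_eq_Icc n.cast_nonneg (le_add_of_nonneg_right zero_le_one)]
      refine ih.union_of_isClosed ?_ isClosed_Icc isClosed_Icc
      exact ((p n).continuous_extend.comp (continuous_id.sub continuous_const)).continuousOn.congr
        (hpiece n)
  intro t ht
  obtain ⟨n, hn⟩ := exists_nat_gt t
  refine (hfin n t ⟨ht, hn.le⟩).mono_of_mem_nhdsWithin ?_
  rw [← Ici_inter_Iic]
  exact inter_mem_nhdsWithin _ (Iic_mem_nhds hn)

theorem isAccessible_of_chain {X : Type*} [MetricSpace X] [LocallyPathConnectedSpace X]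
    {Ω : Set X} {E : EndChain Ω} (hE : ∀ k, IsOpen (E.sets k)) {x : X} (hx : x ∈ frontier Ω)
    (hlim : ∀ ε > 0, ∃ k, ∀ y ∈ E.sets k, dist y x < ε) : IsAccessible Ω x := by
  choose w hw using E.nonempty
  have hjoin : ∀ k, JoinedIn (E.sets k) (w k) (w (k + 1)) := fun k =>
    ((hE k).isConnected_iff_isPathConnected.1 (E.acceptable k).2.2.1).joinedIn _ (hw k) _
      (E.succ_subset k (hw (k + 1)))
  obtain ⟨g, hg, hgE⟩ := exists_concatenation hjoin
  -- The substitution `s / (1 - s)` carries `[0, 1)` to `[0, ∞)`; for `s > 1 - 1 / (k + 1)` it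
  -- exceeds `k`, so the curve is then in `E_k`.
  refine ⟨hx, fun s => if s < 1 then g (s / (1 - s)) else x, ?_, by simp, fun t ht => ?_⟩
  · intro s hs
    rcases hs.2.lt_or_eq with hlt | rfl
    · have h1 : ContinuousWithinAt (fun s : ℝ => g (s / (1 - s))) (Icc 0 1 ∩ Iio 1) s := by
        refine ContinuousWithinAt.comp (t := Ici 0) (hg _ ?_) ?_ ?_
        · exact div_nonneg hs.1 (sub_nonneg.2 hs.2)
        · refine (continuousAt_id.div (continuousAt_const.sub continuousAt_id) ?_).continuousWithinAt
          exact (sub_pos.2 hlt).ne'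
        · exact fun u hu => div_nonneg hu.1.1 (sub_nonneg.2 hu.1.2)
      have h2 := h1.congr (g := fun s => if s < 1 then g (s / (1 - s)) else x)
        (fun u hu => if_pos hu.2) (if_pos hlt)
      exact h2.mono_of_mem_nhdsWithin (inter_mem_nhdsWithin _ (Iio_mem_nhds hlt))
    · rw [ContinuousWithinAt, if_neg (lt_irrefl 1), Metric.tendsto_nhds]
      intro ε hε
      obtain ⟨k, hk⟩ := hlim ε hε
      have hδ : (1 : ℝ) - 1 / (k + 1) < 1 := sub_lt_self _ (by positivity)
      filter_upwards [mem_nhdsWithin_of_mem_nhds (Ioi_mem_nhds hδ), self_mem_nhdsWithin]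
        with u hu hu1
      split_ifs with h1
      · refine hk _ (E.antitone (Nat.le_floor ?_) (hgE _))
        rw [le_div_iff₀ (sub_pos.2 h1)]
        rw [mem_Ioi, sub_lt_comm, lt_div_iff₀ (by positivity)] at hu
        linarith
      · rwa [dist_self]
  · dsimp only
    rw [if_pos ht.2]
    exact E.subset _ (hgE _)

end Accessible

/-! ### The homeomorphism between the prime end closure and the Mazurkiewicz closure -/

section Homeomorph

variable {X : Type*} [MetricSpace X] {Ω : Set X} {M : Type*} [MetricSpace M] {ι : Ω → M}

/-- A point of the domain lies at its image only, an end accumulates where its chains do. -/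
def EndClosure.LiesAt (ι : Ω → M) : EndClosure Ω → M → Prop
  | point x, m => ι x = m
  | ofEnd e, m => ∃ F : EndChain Ω, DomainEnd.mk F = e ∧ F.AccumulatesAt ι m

namespace EndClosure

theorem isClosed_iff {C : Set (EndClosure Ω)} : IsClosed C ↔ IsSeqClosedSet C := by
  rw [← isOpen_compl_iff]
  change Cᶜᶜ ∈ {C | IsSeqClosedSet C} ↔ _
  rw [compl_compl, mem_ofPred_eq]

theorem exists_liesAt [CompactSpace M] (ι : Ω → M) (y : EndClosure Ω) : ∃ m, y.LiesAt ι m := by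
  cases y with
  | point x => exact ⟨ι x, rfl⟩
  | ofEnd e =>
    obtain ⟨F, rfl⟩ := e.exists_mk
    obtain ⟨m, hm⟩ := F.exists_accumulatesAt ι
    exact ⟨m, F, rfl, hm⟩

theorem LiesAt.exists_dist_lt {y : EndClosure Ω} {m : M} (h : y.LiesAt ι m) {A : Set X}
    (hy : y.LiesIn A) {δ : ℝ} (hδ : 0 < δ) :
    ∃ z : Ω, (z : X) ∈ A ∧ dist (ι z) m < δ := by
  cases y with
  | point x =>
    obtain rfl : ι x = m := h
    exact ⟨x, hy, by rwa [dist_self]⟩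
  | ofEnd e =>
    obtain ⟨F, rfl, hF⟩ := h
    obtain ⟨l, hl⟩ : F.EventuallyIn A := hy
    obtain ⟨z, hz, hzm⟩ := hF l δ hδ
    exact ⟨z, hl hz, hzm⟩

/-- The points of `EndClosure Ω` which belong to the prime end closure. -/
def IsPrimeOrPoint (y : EndClosure Ω) : Prop := ∀ e : DomainEnd Ω, y = ofEnd e → e.IsPrime

theorem LiesAt.of_tendsto [LocallyConnectedSpace X] (hι : IsMazurkiewiczEmbedding ι)
    (hΩ : IsOpen Ω) {y : ℕ → EndClosure Ω} {b : EndClosure Ω} {m : ℕ → M} {m₀ : M}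
    (h : ∀ n, (y n).LiesAt ι (m n)) (hm : Tendsto m atTop (𝓝 m₀)) (hy : ConvergesTo y b) :
    b.LiesAt ι m₀ := by
  cases b with
  | point x =>
    refine tendsto_nhds_unique (Metric.tendsto_nhds.2 fun ε hε => ?_) hm
    obtain ⟨δ, hδ, hδε⟩ := hι.exists_dist_lt_of_dist_lt hΩ x hε
    filter_upwards [hy δ hδ] with n hn
    obtain ⟨z, hz, hzx⟩ := hn
    have := h n
    rw [hz] at this
    obtain this : ι z = m n := this
    rw [← this]
    exact hδε z hzx
  | ofEnd e =>
    obtain ⟨F, rfl⟩ := e.exists_mk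
    refine ⟨F, rfl, fun k δ hδ => ?_⟩
    obtain ⟨n, hn, hnm⟩ := ((hy F rfl k).and
      (Metric.tendsto_nhds.1 hm (δ / 2) (half_pos hδ))).exists
    obtain ⟨z, hz, hzm⟩ := (h n).exists_dist_lt hn (half_pos hδ)
    exact ⟨z, hz, by linarith [dist_triangle (ι z) (m n) m₀]⟩

variable (hι : IsMazurkiewiczEmbedding ι) [CompleteSpace X] [LocallyPathConnectedSpace X]
  (hΩ : IsOpen Ω)
include hι hΩ

theorem LiesAt.liesIn {y : EndClosure Ω} {m m' : M} (h : y.LiesAt ι m') (hy : y.IsPrimeOrPoint)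
    {A : Set X} {δ : ℝ} (hδ : 0 < δ) (hA : ∀ z : Ω, dist (ι z) m < δ → (z : X) ∈ A)
    (hd : dist m' m < δ / 2) : y.LiesIn A := by
  cases y with
  | point x =>
    obtain rfl : ι x = m' := h
    exact hA x (by linarith)
  | ofEnd e =>
    obtain ⟨F, rfl, hF⟩ := h
    obtain ⟨k, hk⟩ := (hF.represents hι hΩ (hy _ rfl)).exists_dist_lt (δ / 2) (half_pos hδ)
    refine ⟨k, fun z hz => hA ⟨z, F.subset k hz⟩ ?_⟩
    linarith [hk ⟨z, F.subset k hz⟩ hz, dist_triangle (ι ⟨z, F.subset k hz⟩) m' m]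

theorem convergesTo_of_tendsto {y : ℕ → EndClosure Ω} {b : EndClosure Ω} {m : ℕ → M} {m₀ : M}
    (h : ∀ n, (y n).LiesAt ι (m n)) (hy : ∀ n, (y n).IsPrimeOrPoint) (hb : b.LiesAt ι m₀)
    (hb' : b.IsPrimeOrPoint) (hm : Tendsto m atTop (𝓝 m₀)) : ConvergesTo y b := by
  cases b with
  | point x =>
    obtain rfl : ι x = m₀ := hb
    intro ε hε
    -- Near a point of `Ω`, the completion contains only points of `Ω`, whereas ends accumulate
    -- outside the range of `ι`; so the late terms are points.
    have h1 : ∀ᶠ n in atTop, hι.proj (m n) ∈ Ω :=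
      (hι.continuous_proj.tendsto _).comp hm (hΩ.mem_nhds (by rw [hι.proj_apply]; exact x.2))
    filter_upwards [h1, Metric.tendsto_nhds.1 hm ε hε] with n hn hnε
    rw [hι.proj_mem_iff hΩ] at hn
    have h2 := h n
    cases hyn : y n with
    | point z =>
      rw [hyn] at h2
      obtain h2 : ι z = m n := h2
      rw [← h2] at hnε
      exact ⟨z, rfl, (hι.dist_le z x).trans_lt hnε⟩
    | ofEnd e =>
      rw [hyn] at h2
      obtain ⟨F, -, hF⟩ := h2
      exact absurd hn (hF.notMem_range hι hΩ)
  | ofEnd e =>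
    rintro E rfl k
    obtain ⟨F, hFE, hF⟩ := hb
    obtain ⟨h1, h2⟩ := DomainEnd.mk_eq_mk.1 hFE
    have hE : E.Represents ι m₀ :=
      (hF.represents hι hΩ (hFE ▸ hb' _ rfl)).of_equiv h1 h2
    obtain ⟨δ, hδ, hδE⟩ := hE.exists_mem k
    filter_upwards [Metric.tendsto_nhds.1 hm (δ / 2) (half_pos hδ)] with n hn
    exact (h n).liesIn hι hΩ (hy n) hδ hδE hn

theorem LiesAt.unique {y : EndClosure Ω} (hy : y.IsPrimeOrPoint) {m m' : M} (h : y.LiesAt ι m)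
    (h' : y.LiesAt ι m') : m = m' := by
  cases y with
  | point x => exact Eq.trans (Eq.symm h) h'
  | ofEnd e =>
    obtain ⟨F, rfl, hF⟩ := h
    obtain ⟨F', hFF', hF'⟩ := h'
    exact (hF.represents hι hΩ (hy _ rfl)).eq_of_divides
      (hF'.represents hι hΩ (hFF' ▸ hy _ rfl)) (DomainEnd.mk_eq_mk.1 hFF').2

theorem LiesAt.eq {y y' : EndClosure Ω} (hy : y.IsPrimeOrPoint) (hy' : y'.IsPrimeOrPoint) {m : M}
    (h : y.LiesAt ι m) (h' : y'.LiesAt ι m) : y = y' := by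
  cases y with
  | point x =>
    cases y' with
    | point x' => rw [hι.injective (Eq.trans h (Eq.symm h'))]
    | ofEnd e =>
      obtain ⟨F, rfl, hF⟩ := h'
      exact absurd ⟨x, h⟩ (hF.notMem_range hι hΩ)
  | ofEnd e =>
    obtain ⟨F, rfl, hF⟩ := h
    cases y' with
    | point x' => exact absurd ⟨x', h'⟩ (hF.notMem_range hι hΩ)
    | ofEnd e' =>
      obtain ⟨F', rfl, hF'⟩ := h'
      rw [DomainEnd.mk_eq_mk.2 ⟨(hF.represents hι hΩ (hy _ rfl)).divides hι hF',
        (hF'.represents hι hΩ (hy' _ rfl)).divides hι hF⟩]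

variable [CompactSpace M]

theorem exists_isPrimeOrPoint_liesAt (m : M) :
    ∃ y : EndClosure Ω, y.IsPrimeOrPoint ∧ y.LiesAt ι m := by
  by_cases hm : m ∈ range ι
  · obtain ⟨x, rfl⟩ := hm
    have hx : (point x : EndClosure Ω).IsPrimeOrPoint := fun e he => nomatch he
    exact ⟨point x, hx, rfl⟩
  · obtain ⟨E, hE, -⟩ := EndChain.exists_represents hι hΩ hm
    refine ⟨ofEnd (DomainEnd.mk E), fun e he => ?_, E, rfl, hE.accumulatesAt hι.dense⟩
    cases he
    exact hE.isPrime hι hΩ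

end EndClosure

variable (hι : IsMazurkiewiczEmbedding ι) [CompleteSpace X] [LocallyPathConnectedSpace X]
  (hΩ : IsOpen Ω) [CompactSpace M]
include hι hΩ

theorem exists_homeomorph : ∃ Φ : PrimeEndClosure Ω ≃ₜ M,
    ∀ x : Ω, Φ (PrimeEndClosure.ofPoint x) = ι x := by
  choose f hf using fun y : PrimeEndClosure Ω => EndClosure.exists_liesAt ι y.1
  have hf_eq : ∀ (y : PrimeEndClosure Ω) {m : M}, y.1.LiesAt ι m → f y = m := fun y m h =>
    (hf y).unique hι hΩ y.2 h
  have hbij : Function.Bijective f := by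
    refine ⟨fun y y' h => Subtype.ext ((hf y).eq hι hΩ y.2 y'.2 (h ▸ hf y')), fun m => ?_⟩
    obtain ⟨y, hy, hym⟩ := EndClosure.exists_isPrimeOrPoint_liesAt hι hΩ m
    exact ⟨⟨y, hy⟩, hf_eq ⟨y, hy⟩ hym⟩
  have hcont : Continuous f := by
    -- The topology is induced from the space of all ends, so the closed set must include non-prime
    -- ends too: everything that lies at some point of `D`. Compactness of `D` makes it closed under
    -- limits.
    refine continuous_iff_isClosed.2 fun D hD => isClosed_induced_iff.2
      ⟨{y | ∃ m ∈ D, y.LiesAt ι m}, EndClosure.isClosed_iff.2 fun y b hy hb => ?_, ?_⟩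
    · choose m hmD hm using hy
      obtain ⟨m₀, hm₀, φ, hφ, hlim⟩ := hD.isCompact.tendsto_subseq hmD
      exact ⟨m₀, hm₀, EndClosure.LiesAt.of_tendsto hι hΩ (fun n => hm (φ n)) hlim (hb.comp hφ)⟩
    · ext y
      refine ⟨?_, fun hy => ⟨f y, hy, hf y⟩⟩
      rintro ⟨m, hmD, hm⟩
      rw [mem_preimage, hf_eq y hm]
      exact hmD
  have hclosed : IsClosedMap f := by
    intro C hC
    obtain ⟨C', hC', rfl⟩ := isClosed_induced_iff.1 hC
    refine IsSeqClosed.isClosed fun m m₀ hm hlim => ?_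
    choose y hyC hym using hm
    obtain ⟨b, rfl⟩ := hbij.2 m₀
    exact ⟨b, EndClosure.isClosed_iff.1 hC' (fun n => (y n).1) b.1 hyC
      (EndClosure.convergesTo_of_tendsto hι hΩ (fun n => hym n ▸ hf (y n)) (fun n => (y n).2)
        (hf b) b.2 hlim), rfl⟩
  refine ⟨(Equiv.ofBijective f hbij).toHomeomorphOfContinuousClosed hcont hclosed, fun x => ?_⟩
  exact hf_eq _ rfl

theorem metrizableSpace_primeEndClosure : TopologicalSpace.MetrizableSpace (PrimeEndClosure Ω) := by
  obtain ⟨Φ, -⟩ := exists_homeomorph hι hΩ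
  exact Φ.isEmbedding.metrizableSpace

theorem compactSpace_primeEndClosure : CompactSpace (PrimeEndClosure Ω) := by
  obtain ⟨Φ, -⟩ := exists_homeomorph hι hΩ
  exact Φ.symm.compactSpace

end Homeomorph

/-! ### Modulus estimates on annuli, and `Mod_p`-ends -/

section Modulus

theorem volume_image_le_of_dist_le {f : ℝ → ℝ} {S : Set ℝ}
    (hf : ∀ s ∈ S, ∀ t ∈ S, dist (f s) (f t) ≤ dist s t) : volume (f '' S) ≤ volume S := by
  have hl : LipschitzOnWith 1 f S := LipschitzOnWith.of_dist_le_mul fun s hs t ht => by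
    rw [NNReal.coe_one, one_mul]
    exact hf s hs t ht
  simpa [hausdorffMeasure_real] using hl.hausdorffMeasure_image_le (d := 1) zero_le_one

/-- A curve which crosses an annulus has at least the length of its width there. -/
theorem mul_le_lineIntegral_annulus {X : Type*} [PseudoMetricSpace X] (γ : RectCurve X) (x : X)
    {a b : ℝ} (c : ℝ≥0∞) (ha : dist (γ.toFun 0) x ≤ a) (hb : b ≤ dist (γ.toFun γ.len) x) :
    c * ENNReal.ofReal (b - a) ≤
      lineIntegral ({y | dist y x ∈ Ioo a b}.indicator fun _ => c) γ := by
  have hcont : ContinuousOn (fun t => dist (γ.toFun t) x) (Icc 0 γ.len) :=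
    continuous_dist.comp_continuousOn
      ((continuousOn_of_hasUnitSpeedOn γ.unitSpeed).prodMk continuousOn_const)
  set S := Icc 0 γ.len ∩ (fun t => dist (γ.toFun t) x) ⁻¹' Ioo a b with hS
  have hSm : MeasurableSet S := by
    obtain ⟨V, hV, hVS⟩ := continuousOn_iff'.1 hcont (Ioo a b) isOpen_Ioo
    rw [hS, inter_comm, hVS]
    exact hV.measurableSet.inter measurableSet_Icc
  -- Along the curve the distance to `x` is 1-Lipschitz and takes every value in `(a, b)`, so the
  -- time spent in the annulus is at least `b - a`.
  have hvol : ENNReal.ofReal (b - a) ≤ volume S := by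
    rw [← Real.volume_Ioo]
    refine le_trans (measure_mono fun r hr => ?_)
      (volume_image_le_of_dist_le (f := fun t => dist (γ.toFun t) x) fun s hs t ht =>
        (dist_dist_dist_le_left _ _ _).trans (dist_le_of_hasUnitSpeedOn γ.unitSpeed hs.1 ht.1))
    obtain ⟨t, ht, rfl⟩ := intermediate_value_Icc γ.len_pos.le hcont
      (⟨ha.trans hr.1.le, hr.2.le.trans hb⟩ : r ∈ Icc _ _)
    exact ⟨t, ⟨ht, hr⟩, rfl⟩
  calc c * ENNReal.ofReal (b - a) ≤ c * volume S := by gcongr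
    _ = ∫⁻ _ in S, c := (setLIntegral_const _ _).symm
    _ ≤ ∫⁻ t in S, ({y | dist y x ∈ Ioo a b}.indicator (fun _ => c)) (γ.toFun t) :=
      setLIntegral_mono' hSm fun t ht => by rw [indicator_of_mem (by exact ht.2)]
    _ ≤ _ := lintegral_mono_set inter_subset_left

theorem sum_lineIntegral_le {X : Type*} [PseudoMetricSpace X] (γ : RectCurve X) (N : ℕ)
    (ρ : ℕ → X → ℝ≥0∞) :
    ∑ i ∈ Finset.range N, lineIntegral (ρ i) γ ≤
      lineIntegral (fun y => ∑ i ∈ Finset.range N, ρ i y) γ := by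
  induction N with
  | zero => simp
  | succ N ih =>
    simp only [Finset.sum_range_succ]
    exact (add_le_add_left ih _).trans (le_lintegral_add _ _)

variable {X : Type*} [PseudoMetricSpace X] [MeasurableSpace X] {μ : Measure X} {p : ℝ}

theorem exists_measure_ball_le_of_mem_dimSet (hball : BallsPosFinite μ) {x : X} {q : ℝ}
    (hq : q ∈ dimSet μ x) : ∃ D R₀ : ℝ, 0 ≤ D ∧ 0 < R₀ ∧ ∀ r, 0 < r → r ≤ R₀ →
      μ (Metric.ball x r) ≤ ENNReal.ofReal (D * r ^ q) := by
  obtain ⟨-, C, hC, R₀, hR₀, h⟩ := hq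
  have hpos : 0 < μ.real (Metric.ball x R₀) :=
    ENNReal.toReal_pos (hball x R₀ hR₀).1.ne' (hball x R₀ hR₀).2.ne
  refine ⟨C * μ.real (Metric.ball x R₀) / R₀ ^ q, R₀, by positivity, hR₀, fun r hr hrR => ?_⟩
  have h1 := h r R₀ hr hrR le_rfl
  rw [div_le_iff₀ hpos, Real.div_rpow hr.le hR₀.le] at h1
  rw [← ENNReal.ofReal_toReal (hball x r hr).2.ne]
  refine ENNReal.ofReal_le_ofReal (h1.trans_eq ?_)
  ring

/-- The dimension set is closed under passing to smaller positive exponents; containing `1` but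
nothing larger, it would equal `(0, 1]`. -/
theorem exists_one_lt_mem_dimSet {x : X} (h1 : 1 ∈ dimSet μ x) (h : dimSet μ x ≠ Ioc 0 1) :
    ∃ q ∈ dimSet μ x, 1 < q := by
  by_contra! hle
  refine h (Subset.antisymm (fun q hq => ⟨hq.1, hle q hq⟩) fun q hq => ⟨hq.1, ?_⟩)
  obtain ⟨-, C, hC, R₀, hR₀, hb⟩ := h1
  refine ⟨C, hC, R₀, hR₀, fun r R hr hrR hR => (hb r R hr hrR hR).trans ?_⟩
  have hR' : 0 < R := hr.trans_le hrR
  gcongr ?_ * ?_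
  exact Real.rpow_le_rpow_of_exponent_ge (by positivity) ((div_le_one hR').2 hrR) hq.2

variable [OpensMeasurableSpace X]

/-- The test function equals `c i` on the `i`-th dyadic annulus. The annuli are disjoint, so its
`p`-th power can be taken term by term. -/
theorem modulus_le_sum (hp : 0 < p) {x : X} {R : ℝ} (hR : 0 < R) {N : ℕ} {c : ℕ → ℝ≥0∞}
    (hc : 1 ≤ ∑ i ∈ Finset.range N, c i * ENNReal.ofReal (R / 2 ^ (i + 1)))
    {Γ : Set (RectCurve X)}
    (hΓ : ∀ γ ∈ Γ, dist (γ.toFun 0) x ≤ R / 2 ^ N ∧ R ≤ dist (γ.toFun γ.len) x) :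
    modulus μ p Γ ≤ ∑ i ∈ Finset.range N, c i ^ p * μ (Metric.ball x (R / 2 ^ i)) := by
  set A : ℕ → Set X := fun i => {y | dist y x ∈ Ioo (R / 2 ^ (i + 1)) (R / 2 ^ i)} with hA
  have hAm : ∀ i, MeasurableSet (A i) := fun i =>
    (isOpen_Ioo.preimage (continuous_id.dist continuous_const)).measurableSet
  have hanti : ∀ i j : ℕ, i ≤ j → R / 2 ^ j ≤ R / 2 ^ i := fun i j hij =>
    div_le_div_of_nonneg_left hR.le (by positivity) (pow_le_pow_right₀ one_le_two hij)
  have hdisj : ∀ i j, i < j → ∀ y, y ∈ A i → y ∉ A j := fun i j hij y hi hj =>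
    absurd (hi.1.trans hj.2) (hanti (i + 1) j hij).not_gt
  refine (iInf₂_le (fun y => ∑ i ∈ Finset.range N, (A i).indicator (fun _ => c i) y)
    (Finset.measurable_sum _ fun i _ => measurable_const.indicator (hAm i))).trans
    ((iInf_le _ fun γ hγ => ?_).trans ?_)
  · refine hc.trans (le_trans (Finset.sum_le_sum fun i hi => ?_)
      (sum_lineIntegral_le γ N fun i => (A i).indicator fun _ => c i))
    have h2 : R / 2 ^ i - R / 2 ^ (i + 1) = R / 2 ^ (i + 1) := by
      rw [pow_succ]
      field_simp
      ring
    have h3 := mul_le_lineIntegral_annulus γ x (a := R / 2 ^ (i + 1)) (b := R / 2 ^ i) (c i)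
      ((hΓ γ hγ).1.trans (hanti _ _ (Finset.mem_range.1 hi)))
      ((div_le_self hR.le (one_le_pow₀ one_le_two)).trans (hΓ γ hγ).2)
    rwa [h2] at h3
  · have hpt : ∀ y, (∑ i ∈ Finset.range N, (A i).indicator (fun _ => c i) y) ^ p =
        ∑ i ∈ Finset.range N, (A i).indicator (fun _ => c i ^ p) y := by
      intro y
      by_cases hy : ∃ j ∈ Finset.range N, y ∈ A j
      · obtain ⟨j, hj, hyj⟩ := hy
        have hne : ∀ i, i ≠ j → y ∉ A i := fun i hij hi => by
          rcases lt_or_gt_of_ne hij with h | h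
          · exact hdisj _ _ h y hi hyj
          · exact hdisj _ _ h y hyj hi
        rw [Finset.sum_eq_single_of_mem j hj fun i _ hij => indicator_of_notMem (hne i hij) _,
          Finset.sum_eq_single_of_mem j hj fun i _ hij => indicator_of_notMem (hne i hij) _,
          indicator_of_mem hyj, indicator_of_mem hyj]
      · push Not at hy
        rw [Finset.sum_eq_zero fun i hi => indicator_of_notMem (hy i hi) _,
          Finset.sum_eq_zero fun i hi => indicator_of_notMem (hy i hi) _, ENNReal.zero_rpow_of_pos hp]
    simp only [hpt]
    rw [lintegral_finsetSum _ fun i _ => measurable_const.indicator (hAm i)]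
    refine Finset.sum_le_sum fun i _ => ?_
    rw [lintegral_indicator_const (hAm i)]
    gcongr
    exact fun y hy => hy.2

/-- The modulus of the curves from small balls around `x` to the complement of a fixed ball
around `x` tends to zero. -/
theorem exists_modulus_le (hp : 1 ≤ p) (hball : BallsPosFinite μ) {x : X}
    (hpx : p ∈ dimSet μ x) (hx : dimSet μ x ≠ Ioc 0 1) {R₀ : ℝ} (hR₀ : 0 < R₀) {η : ℝ}
    (hη : 0 < η) :
    ∃ ε > 0, ∀ Γ : Set (RectCurve X),
      (∀ γ ∈ Γ, dist (γ.toFun 0) x ≤ ε ∧ R₀ ≤ dist (γ.toFun γ.len) x) →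
        modulus μ p Γ ≤ ENNReal.ofReal η := by
  have hp0 : 0 < p := one_pos.trans_le hp
  -- For `p = 1` a single annulus with weight `2 / R` suffices: an exponent `q > 1` bounds the mass
  -- by `2 * D * R ^ (q - 1)`, small for small `R`. For `p > 1`, spread the weight evenly over `N`
  -- dyadic annuli, each contributing `1 / N` to the line integral and at most `D * (2 / N) ^ p` to
  -- the mass; the sum is of order `N ^ (1 - p)`.
  rcases hp.eq_or_lt with rfl | hp1
  · obtain ⟨q, hq, hq1⟩ := exists_one_lt_mem_dimSet hpx hx
    obtain ⟨D, R₁, hD, hR₁, hball'⟩ := exists_measure_ball_le_of_mem_dimSet hball hq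
    have hlim : Tendsto (fun r : ℝ => 2 * D * r ^ (q - 1)) (𝓝 0) (𝓝 0) := by
      have := (Real.continuous_rpow_const (sub_pos.2 hq1).le).tendsto 0
      rw [Real.zero_rpow (sub_pos.2 hq1).ne'] at this
      simpa using this.const_mul (2 * D)
    obtain ⟨δ, hδ, hδη⟩ := Metric.eventually_nhds_iff.1 (hlim.eventually_lt_const hη)
    set R := min (min R₀ R₁) (δ / 2) with hRdef
    have hR : 0 < R := lt_min (lt_min hR₀ hR₁) (half_pos hδ)
    have hR0 : R ≤ R₀ := (min_le_left _ _).trans (min_le_left _ _)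
    have hR1 : R ≤ R₁ := (min_le_left _ _).trans (min_le_right _ _)
    refine ⟨R / 2 ^ 1, by positivity, fun Γ hΓ => ?_⟩
    refine (modulus_le_sum (c := fun _ => ENNReal.ofReal (2 / R)) one_pos hR (N := 1) ?_
      fun γ hγ => ⟨(hΓ γ hγ).1, hR0.trans (hΓ γ hγ).2⟩).trans ?_
    · rw [Finset.sum_range_one, ← ENNReal.ofReal_mul (by positivity), ENNReal.one_le_ofReal]
      apply le_of_eq
      field_simp
      norm_num
    · rw [Finset.sum_range_one, ENNReal.rpow_one, pow_zero, div_one]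
      refine (mul_le_mul_right (hball' R hR hR1) _).trans ?_
      rw [← ENNReal.ofReal_mul (by positivity)]
      refine ENNReal.ofReal_le_ofReal (le_trans (le_of_eq ?_) (@hδη R ?_).le)
      · rw [Real.rpow_sub_one hR.ne']
        ring
      · rw [Real.dist_eq, sub_zero, abs_of_pos hR]
        exact (min_le_right _ _).trans_lt (half_lt_self hδ)
  · obtain ⟨D, R₁, hD, hR₁, hball'⟩ := exists_measure_ball_le_of_mem_dimSet hball hpx
    have hlim : Tendsto (fun n : ℕ => D * 2 ^ p * (n : ℝ) ^ (-(p - 1))) atTop (𝓝 0) := by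
      simpa using ((tendsto_rpow_neg_atTop (sub_pos.2 hp1)).comp
        tendsto_natCast_atTop_atTop).const_mul (D * 2 ^ p)
    obtain ⟨N, hN, hN0⟩ := ((hlim.eventually_lt_const hη).and (eventually_gt_atTop 0)).exists
    have hN' : (0 : ℝ) < N := by exact_mod_cast hN0
    set R := min R₀ R₁
    have hR : 0 < R := lt_min hR₀ hR₁
    refine ⟨R / 2 ^ N, by positivity, fun Γ hΓ => ?_⟩
    refine (modulus_le_sum (c := fun i => ENNReal.ofReal (2 ^ (i + 1) / (R * N))) hp0 hR (N := N) ?_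
      fun γ hγ => ⟨(hΓ γ hγ).1, (min_le_left _ _).trans (hΓ γ hγ).2⟩).trans ?_
    · have h1 : ∀ i : ℕ, ENNReal.ofReal (2 ^ (i + 1) / (R * N)) *
          ENNReal.ofReal (R / 2 ^ (i + 1)) = ENNReal.ofReal (1 / N) := fun i => by
        rw [← ENNReal.ofReal_mul (by positivity)]
        congr 1
        field_simp
      simp only [h1, Finset.sum_const, Finset.card_range, nsmul_eq_mul]
      rw [← ENNReal.ofReal_natCast, ← ENNReal.ofReal_mul hN'.le, mul_one_div_cancel hN'.ne',
        ENNReal.ofReal_one]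
    · have h1 : ∀ i ∈ Finset.range N, ENNReal.ofReal (2 ^ (i + 1) / (R * N)) ^ p *
          μ (Metric.ball x (R / 2 ^ i)) ≤ ENNReal.ofReal (D * (2 / N) ^ p) := fun i _ => by
        have hRi : 0 < R / 2 ^ i := by positivity
        refine (mul_le_mul_right (hball' _ hRi ((div_le_self hR.le
          (one_le_pow₀ one_le_two)).trans (min_le_right _ _))) _).trans ?_
        rw [ENNReal.ofReal_rpow_of_nonneg (by positivity) hp0.le,
          ← ENNReal.ofReal_mul (by positivity), mul_left_comm,
          ← Real.mul_rpow (by positivity) hRi.le]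
        refine ENNReal.ofReal_le_ofReal (le_of_eq ?_)
        congr 2
        field_simp
        ring
      refine (Finset.sum_le_sum h1).trans ?_
      rw [Finset.sum_const, Finset.card_range, nsmul_eq_mul, ← ENNReal.ofReal_natCast,
        ← ENNReal.ofReal_mul hN'.le]
      refine ENNReal.ofReal_le_ofReal (le_trans (le_of_eq ?_) hN.le)
      rw [Real.div_rpow zero_le_two hN'.le, neg_sub, Real.rpow_sub hN', Real.rpow_one]
      ring

theorem EndChain.isModChain {X : Type*} [MetricSpace X] [MeasurableSpace X]
    [OpensMeasurableSpace X] {μ : Measure X} {p : ℝ} (hp : 1 ≤ p) (hball : BallsPosFinite μ)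
    {Ω : Set X} {E : EndChain Ω} {x : X} (hxΩ : x ∉ Ω) (hpx : p ∈ dimSet μ x)
    (hx : dimSet μ x ≠ Ioc 0 1) (hlim : ∀ ε > 0, ∃ k, ∀ y ∈ E.sets k, dist y x < ε) :
    E.IsModChain μ p := by
  intro K hKc hKΩ
  obtain ⟨R, hR, hRK⟩ := Metric.isOpen_iff.1 hKc.isClosed.isOpen_compl x fun h => hxΩ (hKΩ h)
  have hRK' : ∀ y ∈ K, R ≤ dist y x := fun y hy => not_lt.1 fun h => hRK h hy
  refine ENNReal.tendsto_nhds_zero.2 fun η hη => ?_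
  obtain ⟨a, ha0, ha⟩ := ENNReal.lt_iff_exists_nnreal_btwn.1 hη
  obtain ⟨ε, hε, hmod⟩ := exists_modulus_le hp hball hpx hx hR (η := a) (by exact_mod_cast ha0)
  obtain ⟨k, hk⟩ := hlim ε hε
  filter_upwards [eventually_ge_atTop k] with l hl
  refine (hmod _ fun γ hγ => ⟨(hk _ (E.antitone hl hγ.2.1)).le, hRK' _ hγ.2.2⟩).trans ?_
  rw [ENNReal.ofReal_coe_nnreal]
  exact ha.le

end Modulus

/-! ### Compactness of the Mazurkiewicz closure -/

section Completion

variable {X : Type*} [MetricSpace X] {Ω : Set X}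

theorem mazurkiewiczDist_ne_top (hΩ : IsConnected Ω) (hb : Bornology.IsBounded Ω) (x y : Ω) :
    mazurkiewiczDist Ω x y ≠ ∞ :=
  ne_top_of_le_ne_top (Metric.isBounded_iff_ediam_ne_top.1 hb)
    (mazurkiewiczDist_le_ediam hΩ Subset.rfl x.2 y.2)

theorem exists_metric_mazurkiewiczClosure [ProperSpace X] [LocallyPathConnectedSpace X]
    (hΩ : IsAlmostJohnDomain Ω) :
    ∃ m : MetricSpace (MazurkiewiczClosure Ω),
      m.toUniformSpace = UniformSpace.Completion.uniformSpace (Mazurkiewicz Ω) ∧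
      CompactSpace (MazurkiewiczClosure Ω) ∧
      IsMazurkiewiczEmbedding (MazurkiewiczClosure.ofPoint (Ω := Ω)) := by
  have htb := totallyBounded_mazurkiewicz hΩ
  let _ : MetricSpace (Mazurkiewicz Ω) := EMetricSpace.toMetricSpace fun x y =>
    mazurkiewiczDist_ne_top hΩ.1.2.1 hΩ.1.2.2.1 x y
  refine ⟨inferInstanceAs (MetricSpace (UniformSpace.Completion (Mazurkiewicz Ω))), rfl, ?_,
    fun x y => ?_, ?_⟩
  · refine ⟨?_⟩
    rw [← UniformSpace.Completion.denseRange_coe.closure_range, ← image_univ]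
    exact (htb.image (UniformSpace.Completion.uniformContinuous_coe _)).closure.isCompact_of_isClosed
      isClosed_closure
  · exact UniformSpace.Completion.edist_eq (α := Mazurkiewicz Ω) x y
  · exact UniformSpace.Completion.denseRange_coe (α := Mazurkiewicz Ω)

end Completion
end PrimeEnds

theorem mainTheorem7 {X : Type*} [MetricSpace X] [CompleteSpace X]
    [MeasurableSpace X] [BorelSpace X] (μ : Measure X) (p : ℝ) (hp : 1 ≤ p)
    (hball : PrimeEnds.BallsPosFinite μ) (hdoubling : PrimeEnds.IsDoubling μ)
    (hpoincare : PrimeEnds.SupportsPoincare μ p)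
    (Ω : Set X) (hΩ : PrimeEnds.IsAlmostJohnDomain Ω) :
    (∀ e : PrimeEnds.DomainEnd Ω, ∃ f : PrimeEnds.DomainEnd Ω, f.IsPrime ∧ f.Divides e) ∧
    (∀ e : PrimeEnds.DomainEnd Ω, e.IsPrime → ∃ x : X, e.impression = {x}) ∧
    (∀ x ∈ frontier Ω, PrimeEnds.IsAccessible Ω x ∧
      ∃ e : PrimeEnds.DomainEnd Ω, e.IsPrime ∧ e.impression = {x}) ∧
    (∃ Φ : PrimeEnds.PrimeEndClosure Ω ≃ₜ PrimeEnds.MazurkiewiczClosure Ω,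
      ∀ x : Ω, Φ (PrimeEnds.PrimeEndClosure.ofPoint x) =
        PrimeEnds.MazurkiewiczClosure.ofPoint x) ∧
    ((∀ x ∈ frontier Ω, p ∈ PrimeEnds.dimSet μ x ∧ PrimeEnds.dimSet μ x ≠ Ioc 0 1) →
      {e : PrimeEnds.DomainEnd Ω | e.IsPrime} =
        {e : PrimeEnds.DomainEnd Ω | e.IsModPrime μ p}) ∧
    (TopologicalSpace.MetrizableSpace (PrimeEnds.PrimeEndClosure Ω) ∧
      CompactSpace (PrimeEnds.PrimeEndClosure Ω)) := by
  have hproper := PrimeEnds.properSpace_of_isDoubling hball hdoubling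
  have hlpc := PrimeEnds.locallyPathConnectedSpace_of_poincare hp hball hdoubling hpoincare
  have hopen : IsOpen Ω := hΩ.1.1
  obtain ⟨m, hm, hcompact, hι⟩ := PrimeEnds.exists_metric_mazurkiewiczClosure hΩ
  rw [← hm] at hcompact
  obtain ⟨Φ, hΦ⟩ := PrimeEnds.exists_homeomorph hι hopen
  have hdiv := PrimeEnds.DomainEnd.exists_isPrime_divides hι hopen
  have hmod : (∀ x ∈ frontier Ω, p ∈ PrimeEnds.dimSet μ x ∧ PrimeEnds.dimSet μ x ≠ Ioc 0 1) →
      ∀ e : PrimeEnds.DomainEnd Ω, e.IsPrime → e.IsModEnd μ p := by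
    intro hdim e he
    obtain ⟨E, b, rfl, hE⟩ := he.exists_represents hι hopen
    have hb : hι.proj b ∈ frontier Ω :=
      hι.proj_mem_frontier hopen ((hE.accumulatesAt hι.dense).notMem_range hι hopen)
    refine ⟨E, E.isModChain hp hball ?_ (hdim _ hb).1 (hdim _ hb).2
      fun ε hε => hE.exists_dist_proj_lt hι hε, rfl⟩
    rw [hopen.frontier_eq] at hb
    exact hb.2
  refine ⟨hdiv, fun e he => he.exists_impression_eq hι hopen, fun x hx => ?_, ?_,
    fun hdim => Subset.antisymm (fun e he => ?_) fun e he => ?_,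
    PrimeEnds.metrizableSpace_primeEndClosure hι hopen,
    PrimeEnds.compactSpace_primeEndClosure hι hopen⟩
  · obtain ⟨E, b, hE, hEo, hEx⟩ := PrimeEnds.exists_represents_of_mem_frontier hι hopen hx
    refine ⟨PrimeEnds.isAccessible_of_chain hEo hx fun ε hε => ?_,
      PrimeEnds.DomainEnd.mk E, hE.isPrime hι hopen, hEx⟩
    rw [hE.impression_eq hι] at hEx
    rw [← singleton_injective hEx]
    exact hE.exists_dist_proj_lt hι hε
  · rw [← hm]
    exact ⟨Φ, hΦ⟩
  · exact ⟨hmod hdim e he, fun f _ hf => he f hf⟩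
  -- Some prime end divides `e`; being a `Mod_p`-end, it equals `e` because `e` is `Mod_p`-prime.
  · obtain ⟨f, hf, hfe⟩ := hdiv e
    rwa [mem_ofPred_eq, ← he.2 f (hmod hdim f hf) hfe]
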